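/- Let $(X,d)$ be a proper geodesic metric space that is Gromov hyperbolic, i.e. for some $\delta>0$ one has $\langle x,y\rangle_a\ge\min\{\langle x,z\rangle_a,\langle z,y\rangle_a\}-\delta/4$ for all $x,y,z,a\in X$, where $\langle x,y\rangle_a=\frac12(d(x,a)+d(y,a)-d(x,y))$. Fix $x_0\in X$ and put $\|x\|=d(x,x_0)$. **Definitions.** A *sublinear function* is a function $\kappa:[0,\infty)\to[1,\infty)$ with $\lim_{t\to\infty}\kappa(t)/t=0$. An *integral $(k,k)$-quasi-geodesic* starting at $y\in X$ is a map $g$ from $\{1,\dots,n\}$ or from $\{1,2,\dots\}$ (then $g$ is a *ray*) to $X$ with $g(1)=y$ and $\frac{|i-j|}{k}-k\le d(g(i),g(j))\le k|i-j|+k$ for all $i,j$. For such a ray $g$, the *$m$-cone* of $g$ is the set of all $h(i)$, where $i\ge m$ and $h$ is a finite or infinite integral $(k,k)$-quasi-geodesic starting at $g(1)$, defined at $1,\dots,m$ and at $i$, with $h(j)=g(j)$ for $j\le m$. A bounded continuous function $f:X\to\mathbb C$ is *geometrically slowly oscillating* if (i) $f(x_n)-f(y_n)\to0$ whenever $x_n\to\infty$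 and the distances $d(x_n,y_n)$ are bounded, and (ii) for every $\epsilon>0$, every real $k\ge1$ and every integral $(k,k)$-quasi-geodesic ray $g$ in $X$ there is $m\ge1$ such that the image under $f$ of the $m$-cone of $g$ has diameter less than $\epsilon$. It is *sublinearly slowly oscillating* if for every sublinear $\kappa$ and every $\epsilon>0$ there is a bounded set $B\subset X$ such that $|f(x)-f(y)|\le\epsilon$ for all $x,y\in X\setminus B$ with $d(x,y)\le\kappa(\|x\|)$. For a fixed sublinear $\kappa$, it is *$\kappa$-slowly oscillating* if for all $C,\epsilon>0$ there is a bounded set $B\subset X$ such that $|f(x)-f(y)|\le\epsilon$ for all $x,y\in X\setminus B$ with $d(x,y)\le C\kappa(\|x\|)$. The *sublinear quasi-geodesic compactification* $X_{sQG}$ is the maximal ideal space of the algebra of all bounded continuous $f:X\to\mathbb C$ that are geometrically slowly oscillating and sublinearly slowly oscillating; $X$ maps to it by evaluation, and the *sublinear quasi-geodesic boundary* is $\partial_{sQG}X=X_{sQG}\setminus X$. The *$\kappa$-quasi-geodesic compactification* $X_{\kappa QG}$ and *boundary* $\partial_{\kappa QG}X=X_{\kappa QG}\setminus X$ are defined in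 the same way with $\kappa$-slowly oscillating in place of sublinearly slowly oscillating. The *Gromov boundary* $\partial X$ is the set of classes of sequences $(u_i)$ in $X$ with $\langle u_i,u_j\rangle_{x_0}\to\infty$ as $i,j\to\infty$, where $(u_i)\sim(v_j)$ if $\langle u_i,v_j\rangle_{x_0}\to\infty$ as $i,j\to\infty$. The *Gromov compactification* is $X\cup\partial X$, where $U\subset X\cup\partial X$ is open if $U\cap X$ is open in $X$ and for each $\xi\in U\cap\partial X$ there is $R$ such that $U$ contains every $z\in X\cup\partial X$ for which some sequences $(u_i)$, $(v_j)$ representing $\xi$ and $z$ (a point of $X$ is represented by the constant sequence) satisfy $\langle u_i,v_j\rangle_{x_0}\ge R$ for all large $i,j$; and $\partial X$ has the subspace topology. **Proposition 6.8.** 1. The sublinear quasi-geodesic boundary of $X$ equals the Gromov boundary of $X$: there is a homeomorphism $X_{sQG}\to X\cup\partial X$ that is the identity on $X$ and restricts to a homeomorphism $\partial_{sQG}X\to\partial X$. 2. For every sublinear function $\kappa$, the $\kappa$-quasi-geodesic boundary of $X$ equals the Gromov boundary of $X$ in the same sense: there is a homeomorphism $X_{\kappa QG}\to X\cup\partial X$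 that is the identity on $X$ and restricts to a homeomorphism $\partial_{\kappa QG}X\to\partial X$. 3. Let $\kappa$ be a sublinear function and let $g,h:[0,\infty)\to X$ be geodesic rays with $g(0)=h(0)=x_0$ that $\kappa$-track each other, i.e. for some $C>1$ one has $d(g(t),h(t))\le C\,\kappa(\|g(t)\|)$ for all sufficiently large $t$. Then $g$ and $h$ are at bounded distance from one another: $\sup_{t\ge0}d(g(t),h(t))<\infty$. -/

import Mathlib

open Filter Topology Bornology
open scoped BoundedContinuousFunction

/-! ### Geodesics and Gromov hyperbolicity -/

/-- A geodesic metric space: any two points are joined by an isometrically embedded segment. -/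
def IsGeodesicSpace (X : Type*) [MetricSpace X] : Prop :=
  ∀ x y : X, ∃ γ : ℝ → X, γ 0 = x ∧ γ (dist x y) = y ∧
    ∀ s ∈ Set.Icc 0 (dist x y), ∀ t ∈ Set.Icc 0 (dist x y), dist (γ s) (γ t) = |s - t|

/-- A geodesic ray `g : [0, ∞) → X` based at `x₀` (values at negative arguments are irrelevant). -/
def IsGeodesicRay {X : Type*} [MetricSpace X] (x₀ : X) (g : ℝ → X) : Prop :=
  g 0 = x₀ ∧ ∀ s t : ℝ, 0 ≤ s → 0 ≤ t → dist (g s) (g t) = |s - t|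

/-- The Gromov product `⟨x, y⟩_a`. -/
noncomputable def gromovProduct {X : Type*} [MetricSpace X] (a x y : X) : ℝ :=
  (dist x a + dist y a - dist x y) / 2

/-- `δ`-hyperbolicity, in the form of the `δ/4`-inequality. -/
def IsDeltaHyperbolic (X : Type*) [MetricSpace X] (δ : ℝ) : Prop :=
  ∀ x y z a : X,
    min (gromovProduct a x z) (gromovProduct a z y) - δ / 4 ≤ gromovProduct a x y

/-- Gromov hyperbolicity: `δ`-hyperbolic for some `δ > 0`. -/
class GromovHyperbolicSpace (X : Type*) [MetricSpace X] : Prop where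
  exists_delta : ∃ δ : ℝ, 0 < δ ∧ IsDeltaHyperbolic X δ

/-! ### The Gromov boundary and the Gromov compactification -/

/-- `⟨u_i, v_j⟩_{x₀} → ∞` as `i, j → ∞`. -/
def GromovClose {X : Type*} [MetricSpace X] (x₀ : X) (u v : ℕ → X) : Prop :=
  Tendsto (fun p : ℕ × ℕ => gromovProduct x₀ (u p.1) (v p.2)) atTop atTop

/-- Sequences converging to infinity: `⟨u_i, u_j⟩_{x₀} → ∞` as `i, j → ∞`. -/
def SeqToInfinity {X : Type*} [MetricSpace X] (x₀ : X) : Type _ :=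
  {u : ℕ → X // GromovClose x₀ u u}

theorem GromovClose.symm {X : Type*} [MetricSpace X] {x₀ : X} {u v : ℕ → X}
    (h : GromovClose x₀ u v) : GromovClose x₀ v u := by
  unfold GromovClose at *
  have hs : Tendsto (Prod.swap : ℕ × ℕ → ℕ × ℕ) atTop atTop := by
    rw [← prod_atTop_atTop_eq]
    exact tendsto_snd.prodMk tendsto_fst
  refine (h.comp hs).congr ?_
  rintro ⟨i, j⟩
  simp only [gromovProduct, Function.comp, Prod.swap, dist_comm (u j) (v i)]
  ring

theorem GromovClose.trans {X : Type*} [MetricSpace X] [GromovHyperbolicSpace X] {x₀ : X}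
    {u v w : ℕ → X} (h : GromovClose x₀ u v) (h' : GromovClose x₀ v w) :
    GromovClose x₀ u w := by
  obtain ⟨δ, -, hδ⟩ := GromovHyperbolicSpace.exists_delta (X := X)
  unfold GromovClose at *
  rw [tendsto_atTop] at *
  intro R
  obtain ⟨a, ha⟩ := eventually_atTop.1 (h (R + δ / 4))
  obtain ⟨b, hb⟩ := eventually_atTop.1 (h' (R + δ / 4))
  refine eventually_atTop.2 ⟨(a.1, b.2), ?_⟩
  rintro ⟨i, j⟩ hij
  have h1 := ha (i, max a.2 b.1) ⟨hij.1, le_max_left _ _⟩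
  have h2 := hb (max a.2 b.1, j) ⟨le_max_right _ _, hij.2⟩
  have h3 := hδ (u i) (w j) (v (max a.2 b.1)) x₀
  have h4 := le_min h1 h2
  simp only at h4 ⊢
  linarith

/-- Two sequences converging to infinity are equivalent if `⟨u_i, v_j⟩_{x₀} → ∞`. -/
instance gromovSetoid {X : Type*} [MetricSpace X] [GromovHyperbolicSpace X] (x₀ : X) :
    Setoid (SeqToInfinity x₀) where
  r u v := GromovClose x₀ u.1 v.1
  iseqv := ⟨fun u => u.2, fun h => h.symm, fun h h' => h.trans h'⟩

/-- The Gromov boundary of `X`: classes of sequences converging to infinity. -/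
def GromovBoundary {X : Type*} [MetricSpace X] [GromovHyperbolicSpace X] (x₀ : X) : Type _ :=
  Quotient (gromovSetoid x₀)

/-- The underlying set `X ∪ ∂X` of the Gromov compactification. -/
inductive GromovCompactification {X : Type*} [MetricSpace X] [GromovHyperbolicSpace X]
    (x₀ : X) : Type _
  | point (x : X) : GromovCompactification x₀
  | ideal (ξ : GromovBoundary x₀) : GromovCompactification x₀

/-- The sequences that represent a point of `X ∪ ∂X`: the constant sequence for a point of `X`,
the members of the class for a boundary point. -/
def GromovCompactification.Represents {X : Type*} [MetricSpace X] [GromovHyperbolicSpace X]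
    {x₀ : X} (v : ℕ → X) : GromovCompactification x₀ → Prop
  | .point x => ∀ j, v j = x
  | .ideal ξ => ∃ hv : GromovClose x₀ v v,
      (Quotient.mk (gromovSetoid x₀) ⟨v, hv⟩ : Quotient (gromovSetoid x₀)) = ξ

/-- The basic neighbourhood of a boundary point `ξ`: the `z ∈ X ∪ ∂X` such that
`⟨u_i, v_j⟩_{x₀} ≥ R` for all large `i, j`, for some sequences `u`, `v` representing `ξ`, `z`. -/
def gromovNhd {X : Type*} [MetricSpace X] [GromovHyperbolicSpace X] {x₀ : X}
    (ξ : GromovBoundary x₀) (R : ℝ) : Set (GromovCompactification x₀) :=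
  {z | ∃ u v : ℕ → X, GromovCompactification.Represents u (.ideal ξ : GromovCompactification x₀) ∧
    GromovCompactification.Represents v z ∧
    ∀ᶠ p : ℕ × ℕ in atTop, R ≤ gromovProduct x₀ (u p.1) (v p.2)}

/-- The topology of the Gromov compactification: `U` is open iff its trace on `X` is open and it
contains a basic neighbourhood of each of its boundary points. -/
instance {X : Type*} [MetricSpace X] [GromovHyperbolicSpace X] (x₀ : X) :
    TopologicalSpace (GromovCompactification x₀) where
  IsOpen U := IsOpen {x : X | GromovCompactification.point x ∈ U} ∧
    ∀ ξ : GromovBoundary x₀, GromovCompactification.ideal ξ ∈ U → ∃ R : ℝ, gromovNhd ξ R ⊆ U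
  isOpen_univ := ⟨by simp, fun _ _ => ⟨0, Set.subset_univ _⟩⟩
  isOpen_inter := by
    rintro U V ⟨hU, hU'⟩ ⟨hV, hV'⟩
    refine ⟨hU.inter hV, ?_⟩
    rintro ξ ⟨h1, h2⟩
    obtain ⟨R, hR⟩ := hU' ξ h1
    obtain ⟨S, hS⟩ := hV' ξ h2
    refine ⟨max R S, ?_⟩
    rintro z ⟨u, v, hu, hv, h⟩
    exact ⟨hR ⟨u, v, hu, hv, h.mono fun _ hp => (le_max_left _ _).trans hp⟩,
      hS ⟨u, v, hu, hv, h.mono fun _ hp => (le_max_right _ _).trans hp⟩⟩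
  isOpen_sUnion := by
    intro s hs
    constructor
    · have : {x : X | GromovCompactification.point x ∈ ⋃₀ s} =
          ⋃ U ∈ s, {x : X | GromovCompactification.point x ∈ U} := by
        ext x; simp
      rw [this]
      exact isOpen_biUnion fun U hU => (hs U hU).1
    · rintro ξ ⟨U, hU, hξ⟩
      obtain ⟨R, hR⟩ := (hs U hU).2 ξ hξ
      exact ⟨R, hR.trans (Set.subset_sUnion_of_mem hU)⟩

/-- The Gromov boundary carries the subspace topology of the Gromov compactification. -/
instance {X : Type*} [MetricSpace X] [GromovHyperbolicSpace X] (x₀ : X) :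
    TopologicalSpace (GromovBoundary x₀) :=
  TopologicalSpace.induced GromovCompactification.ideal inferInstance

/-! ### Integral quasi-geodesics, threads and cones -/

/-- `g` is an integral `(q, Q)`-quasi-geodesic with domain `{1, …, N}`, or all positive integers
if `N = ∞` (values outside of the domain are irrelevant). -/
def IsIntegralQuasiGeodesic {X : Type*} [MetricSpace X] (q Q : ℝ) (N : ℕ∞) (g : ℕ → X) : Prop :=
  ∀ i j : ℕ, 1 ≤ i → (i : ℕ∞) ≤ N → 1 ≤ j → (j : ℕ∞) ≤ N →
    |(i : ℝ) - j| / q - Q ≤ dist (g i) (g j) ∧ dist (g i) (g j) ≤ q * |(i : ℝ) - j| + Q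

/-- The `m`-cone of a ray `g` in the fan of integral `(q, Q)`-quasi-geodesics starting at `x₀`:
all values `h i`, `i ≥ m`, of finite or infinite integral `(q, Q)`-quasi-geodesics `h` that start
at `x₀` and agree with `g` on all indices up to `m`. -/
def quasiGeodesicCone {X : Type*} [MetricSpace X] (x₀ : X) (q Q : ℝ) (g : ℕ → X) (m : ℕ) :
    Set X :=
  {x | ∃ (N : ℕ∞) (h : ℕ → X), (m : ℕ∞) ≤ N ∧ IsIntegralQuasiGeodesic q Q N h ∧ h 1 = x₀ ∧
    (∀ i : ℕ, 1 ≤ i → i ≤ m → h i = g i) ∧ ∃ i : ℕ, m ≤ i ∧ (i : ℕ∞) ≤ N ∧ h i = x}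

/-! ### Slowly oscillating functions -/

/-- Slowly oscillating: `f(x_n) - f(y_n) → 0` whenever `x_n → ∞` and `d(x_n, y_n)` is bounded. -/
def IsSlowlyOscillating {X : Type*} [MetricSpace X] (f : X → ℂ) : Prop :=
  ∀ x y : ℕ → X, Tendsto x atTop (cobounded X) →
    (∃ M : ℝ, 0 < M ∧ ∀ n, dist (x n) (y n) < M) →
    Tendsto (fun n => f (x n) - f (y n)) atTop (𝓝 0)

/-- A bounded continuous function is geometrically slowly oscillating if it is slowly oscillating
and the diameters of its images of the cones of any integral quasi-geodesic ray tend to zero. -/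
def IsGeometricallySlowlyOscillating {X : Type*} [MetricSpace X] (f : X →ᵇ ℂ) : Prop :=
  IsSlowlyOscillating f ∧
    ∀ ε : ℝ, 0 < ε → ∀ k : ℝ, 1 ≤ k → ∀ g : ℕ → X, IsIntegralQuasiGeodesic k k ⊤ g →
      ∃ m : ℕ, 1 ≤ m ∧ Metric.diam (f '' quasiGeodesicCone (g 1) k k g m) < ε

/-- A sublinear function `κ : [0, ∞) → [1, ∞)` (values at negative arguments are irrelevant). -/
def IsSublinear (κ : ℝ → ℝ) : Prop :=
  (∀ t, 0 ≤ t → 1 ≤ κ t) ∧ Tendsto (fun t => κ t / t) atTop (𝓝 0)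

/-- `f` is sublinearly slowly oscillating (with `‖x‖ = d(x, x₀)`). -/
def IsSublinearlySlowlyOscillating {X : Type*} [MetricSpace X] (x₀ : X) (f : X → ℂ) : Prop :=
  ∀ κ : ℝ → ℝ, IsSublinear κ → ∀ ε : ℝ, 0 < ε → ∃ B : Set X, IsBounded B ∧
    ∀ x y : X, x ∉ B → y ∉ B → dist x y ≤ κ (dist x x₀) → ‖f x - f y‖ ≤ ε

/-- `f` is `κ`-slowly oscillating (with `‖x‖ = d(x, x₀)`). -/
def IsKappaSlowlyOscillating {X : Type*} [MetricSpace X] (x₀ : X) (κ : ℝ → ℝ) (f : X → ℂ) :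
    Prop :=
  ∀ C : ℝ, 0 < C → ∀ ε : ℝ, 0 < ε → ∃ B : Set X, IsBounded B ∧
    ∀ x y : X, x ∉ B → y ∉ B → dist x y ≤ C * κ (dist x x₀) → ‖f x - f y‖ ≤ ε

/-! ### These functions form algebras

Each of the conditions says that `f(x) - f(y) → 0` along certain filters on `X × X`. -/

/-- `f(x) - f(y) → 0` along a filter on `X × X`. -/
def VariationVanishes {X : Type*} [MetricSpace X] (L : Filter (X × X)) (f : X → ℂ) : Prop :=
  Tendsto (fun p : X × X => f p.1 - f p.2) L (𝓝 0)

theorem VariationVanishes.const {X : Type*} [MetricSpace X] (L : Filter (X × X)) (c : ℂ) :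
    VariationVanishes L (fun _ => c) := by
  simpa [VariationVanishes] using tendsto_const_nhds

theorem VariationVanishes.add {X : Type*} [MetricSpace X] {L : Filter (X × X)} {f g : X → ℂ}
    (hf : VariationVanishes L f) (hg : VariationVanishes L g) :
    VariationVanishes L (fun x => f x + g x) := by
  have h := Tendsto.add hf hg
  rw [add_zero] at h
  exact h.congr fun p => by ring

theorem VariationVanishes.star {X : Type*} [MetricSpace X] {L : Filter (X × X)} {f : X → ℂ}
    (hf : VariationVanishes L f) : VariationVanishes L (fun x => star (f x)) := by
  have h := Filter.Tendsto.star hf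
  rw [star_zero] at h
  exact h.congr fun p => by simp

theorem VariationVanishes.mul {X : Type*} [MetricSpace X] {L : Filter (X × X)} {f g : X →ᵇ ℂ}
    (hf : VariationVanishes L f) (hg : VariationVanishes L g) :
    VariationVanishes L (fun x => f x * g x) := by
  have h1 : Tendsto (fun p : X × X => (f p.1 - f p.2) * g p.1) L (𝓝 0) :=
    Tendsto.zero_mul_isBoundedUnder_le hf
      (isBoundedUnder_of ⟨‖g‖, fun p => g.norm_coe_le_norm _⟩)
  have h2 : Tendsto (fun p : X × X => f p.2 * (g p.1 - g p.2)) L (𝓝 0) :=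
    isBoundedUnder_le_mul_tendsto_zero
      (isBoundedUnder_of ⟨‖f‖, fun p => f.norm_coe_le_norm _⟩) hg
  have h := h1.add h2
  rw [add_zero] at h
  exact h.congr fun p => by ring

theorem quasiGeodesicCone_anti {X : Type*} [MetricSpace X] (x₀ : X) (q Q : ℝ) (g : ℕ → X) :
    Antitone (quasiGeodesicCone x₀ q Q g) := by
  rintro m n hmn x ⟨N, h, hN, hq, h1, hg, i, hi, hiN, rfl⟩
  exact ⟨N, h, le_trans (by exact_mod_cast hmn) hN, hq, h1,
    fun j hj hjm => hg j hj (hjm.trans hmn), i, hmn.trans hi, hiN, rfl⟩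

theorem cone_iff_variationVanishes {X : Type*} [MetricSpace X] (f : X →ᵇ ℂ) (x₀ : X) (q Q : ℝ)
    (g : ℕ → X) :
    (∀ ε : ℝ, 0 < ε → ∃ m : ℕ, 1 ≤ m ∧
      Metric.diam (f '' quasiGeodesicCone x₀ q Q g m) < ε) ↔
    VariationVanishes
      (⨅ m : ℕ, 𝓟 (quasiGeodesicCone x₀ q Q g m ×ˢ quasiGeodesicCone x₀ q Q g m)) f := by
  have hanti : Antitone fun m : ℕ =>
      quasiGeodesicCone x₀ q Q g m ×ˢ quasiGeodesicCone x₀ q Q g m :=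
    fun m n h => Set.prod_mono (quasiGeodesicCone_anti x₀ q Q g h)
      (quasiGeodesicCone_anti x₀ q Q g h)
  have hb := Filter.hasBasis_iInf_principal (directed_of_isDirected_le
    (r := (· ≥ ·)) (f := fun m : ℕ =>
      quasiGeodesicCone x₀ q Q g m ×ˢ quasiGeodesicCone x₀ q Q g m) (fun m n h => hanti h))
  unfold VariationVanishes
  rw [hb.tendsto_iff Metric.nhds_basis_ball]
  constructor
  · intro H ε hε
    obtain ⟨m, -, hm⟩ := H ε hε
    refine ⟨m, trivial, ?_⟩
    rintro ⟨x, y⟩ ⟨hx, hy⟩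
    have hbd : IsBounded (f '' quasiGeodesicCone x₀ q Q g m) :=
      f.isBounded_range.subset (Set.image_subset_range _ _)
    have := Metric.dist_le_diam_of_mem hbd (Set.mem_image_of_mem _ hx) (Set.mem_image_of_mem _ hy)
    simp only [mem_ball_zero_iff, ← dist_eq_norm]
    exact this.trans_lt hm
  · intro H ε hε
    obtain ⟨m, -, hm⟩ := H (ε / 2) (half_pos hε)
    refine ⟨max m 1, le_max_right _ _, ?_⟩
    refine lt_of_le_of_lt (Metric.diam_le_of_forall_dist_le (half_pos hε).le ?_) (half_lt_self hε)
    rintro _ ⟨x, hx, rfl⟩ _ ⟨y, hy, rfl⟩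
    have := hm (x, y) (hanti (le_max_left m 1) ⟨hx, hy⟩)
    simp only [mem_ball_zero_iff, ← dist_eq_norm] at this
    exact this.le

theorem bounded_iff_variationVanishes {X : Type*} [MetricSpace X] (f : X → ℂ)
    (R : X → X → Prop) :
    (∀ ε : ℝ, 0 < ε → ∃ B : Set X, IsBounded B ∧
      ∀ x y : X, x ∉ B → y ∉ B → R x y → ‖f x - f y‖ ≤ ε) ↔
    VariationVanishes ((cobounded X ×ˢ cobounded X) ⊓ 𝓟 {p | R p.1 p.2}) f := by
  have hbas : (cobounded X).HasBasis (fun B : Set X => IsBounded B) (fun B => Bᶜ) :=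
    ⟨fun s => ⟨fun hs => ⟨sᶜ, isBounded_def.2 (by simpa using hs), by simp⟩,
      fun ⟨B, hB, hs⟩ => mem_of_superset (isBounded_def.1 hB) hs⟩⟩
  have hb := (hbas.prod_self).inf_principal {p : X × X | R p.1 p.2}
  unfold VariationVanishes
  rw [hb.tendsto_iff Metric.nhds_basis_closedBall]
  constructor
  · intro H ε hε
    obtain ⟨B, hB, h⟩ := H ε hε
    refine ⟨B, hB, ?_⟩
    rintro ⟨x, y⟩ ⟨⟨hx, hy⟩, hR⟩
    simpa using h x y hx hy hR
  · intro H ε hε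
    obtain ⟨B, hB, h⟩ := H ε hε
    exact ⟨B, hB, fun x y hx hy hR => by simpa using h (x, y) ⟨⟨hx, hy⟩, hR⟩⟩

theorem exists_filters_geometric (X : Type*) [MetricSpace X] :
    ∃ S : Set (Filter (X × X)), ∀ f : X →ᵇ ℂ,
      IsGeometricallySlowlyOscillating f ↔ ∀ L ∈ S, VariationVanishes L f := by
  refine ⟨{L | (∃ x y : ℕ → X, Tendsto x atTop (cobounded X) ∧
      (∃ M : ℝ, 0 < M ∧ ∀ n, dist (x n) (y n) < M) ∧ L = map (fun n => (x n, y n)) atTop) ∨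
      ∃ (k : ℝ) (g : ℕ → X), 1 ≤ k ∧ IsIntegralQuasiGeodesic k k ⊤ g ∧
        L = ⨅ m : ℕ, 𝓟 (quasiGeodesicCone (g 1) k k g m ×ˢ quasiGeodesicCone (g 1) k k g m)},
    fun f => ⟨?_, ?_⟩⟩
  · rintro ⟨h1, h2⟩ L (⟨x, y, hx, hM, rfl⟩ | ⟨k, g, hk, hg, rfl⟩)
    · exact tendsto_map'_iff.2 (h1 x y hx hM)
    · exact (cone_iff_variationVanishes f (g 1) k k g).1 fun ε hε => h2 ε hε k hk g hg
  · intro H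
    refine ⟨fun x y hx hM => ?_, fun ε hε k hk g hg => ?_⟩
    · exact tendsto_map'_iff.1 (H _ (Or.inl ⟨x, y, hx, hM, rfl⟩))
    · exact (cone_iff_variationVanishes f (g 1) k k g).2 (H _ (Or.inr ⟨k, g, hk, hg, rfl⟩)) ε hε

theorem exists_filters_sublinear {X : Type*} [MetricSpace X] (x₀ : X) :
    ∃ S : Set (Filter (X × X)), ∀ f : X →ᵇ ℂ,
      (IsGeometricallySlowlyOscillating f ∧ IsSublinearlySlowlyOscillating x₀ f) ↔
        ∀ L ∈ S, VariationVanishes L f := by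
  obtain ⟨S, hS⟩ := exists_filters_geometric X
  refine ⟨S ∪ {L | ∃ κ, IsSublinear κ ∧
    L = (cobounded X ×ˢ cobounded X) ⊓ 𝓟 {p | dist p.1 p.2 ≤ κ (dist p.1 x₀)}}, fun f => ?_⟩
  rw [hS]
  constructor
  · rintro ⟨h1, h2⟩ L (hL | ⟨κ, hκ, rfl⟩)
    · exact h1 L hL
    · exact (bounded_iff_variationVanishes f fun x y => dist x y ≤ κ (dist x x₀)).1 (h2 κ hκ)
  · intro H
    exact ⟨fun L hL => H L (Or.inl hL), fun κ hκ =>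
      (bounded_iff_variationVanishes f fun x y => dist x y ≤ κ (dist x x₀)).2
        (H _ (Or.inr ⟨κ, hκ, rfl⟩))⟩

theorem exists_filters_kappa {X : Type*} [MetricSpace X] (x₀ : X) (κ : ℝ → ℝ) :
    ∃ S : Set (Filter (X × X)), ∀ f : X →ᵇ ℂ,
      (IsGeometricallySlowlyOscillating f ∧ IsKappaSlowlyOscillating x₀ κ f) ↔
        ∀ L ∈ S, VariationVanishes L f := by
  obtain ⟨S, hS⟩ := exists_filters_geometric X
  refine ⟨S ∪ {L | ∃ C : ℝ, 0 < C ∧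
    L = (cobounded X ×ˢ cobounded X) ⊓ 𝓟 {p | dist p.1 p.2 ≤ C * κ (dist p.1 x₀)}}, fun f => ?_⟩
  rw [hS]
  constructor
  · rintro ⟨h1, h2⟩ L (hL | ⟨C, hC, rfl⟩)
    · exact h1 L hL
    · exact (bounded_iff_variationVanishes f fun x y => dist x y ≤ C * κ (dist x x₀)).1 (h2 C hC)
  · intro H
    exact ⟨fun L hL => H L (Or.inl hL), fun C hC =>
      (bounded_iff_variationVanishes f fun x y => dist x y ≤ C * κ (dist x x₀)).2
        (H _ (Or.inr ⟨C, hC, rfl⟩))⟩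

/-- A class of bounded continuous functions cut out by conditions `f(x) - f(y) → 0` along a set of
filters is a unital star-subalgebra. -/
def starSubalgebraOfFilters {X : Type*} [MetricSpace X] (P : (X →ᵇ ℂ) → Prop)
    (hP : ∃ S : Set (Filter (X × X)), ∀ f, P f ↔ ∀ L ∈ S, VariationVanishes L f) :
    StarSubalgebra ℂ (X →ᵇ ℂ) where
  carrier := {f | P f}
  mul_mem' := by
    obtain ⟨S, hS⟩ := hP
    intro f g hf hg
    exact (hS _).2 fun L hL => ((hS f).1 hf L hL).mul ((hS g).1 hg L hL)
  add_mem' := by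
    obtain ⟨S, hS⟩ := hP
    intro f g hf hg
    exact (hS _).2 fun L hL => ((hS f).1 hf L hL).add ((hS g).1 hg L hL)
  algebraMap_mem' := by
    obtain ⟨S, hS⟩ := hP
    intro c
    exact (hS _).2 fun L _ => VariationVanishes.const L c
  star_mem' := by
    obtain ⟨S, hS⟩ := hP
    intro f hf
    exact (hS _).2 fun L hL => ((hS f).1 hf L hL).star

/-- The algebra of bounded continuous functions that are geometrically slowly oscillating and
sublinearly slowly oscillating. -/
def sublinearAlgebra {X : Type*} [MetricSpace X] (x₀ : X) : StarSubalgebra ℂ (X →ᵇ ℂ) :=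
  starSubalgebraOfFilters
    (fun f => IsGeometricallySlowlyOscillating f ∧ IsSublinearlySlowlyOscillating x₀ f)
    (exists_filters_sublinear x₀)

/-- The algebra of bounded continuous functions that are geometrically slowly oscillating and
`κ`-slowly oscillating. -/
def kappaAlgebra {X : Type*} [MetricSpace X] (x₀ : X) (κ : ℝ → ℝ) :
    StarSubalgebra ℂ (X →ᵇ ℂ) :=
  starSubalgebraOfFilters
    (fun f => IsGeometricallySlowlyOscillating f ∧ IsKappaSlowlyOscillating x₀ κ f)
    (exists_filters_kappa x₀ κ)

/-! ### Compactifications and boundaries induced by algebras of functions -/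

/-- The compactification induced by an algebra of bounded continuous functions: its maximal ideal
space, i.e. the space of characters with the weak-star topology. -/
abbrev InducedCompactification {X : Type*} [MetricSpace X] (A : StarSubalgebra ℂ (X →ᵇ ℂ)) :
    Type _ :=
  WeakDual.characterSpace ℂ A

/-- The canonical map from `X` to the compactification: evaluation of functions at a point. -/
noncomputable def toCompactification {X : Type*} [MetricSpace X]
    (A : StarSubalgebra ℂ (X →ᵇ ℂ)) (x : X) : InducedCompactification A :=
  ⟨StrongDual.toWeakDual ((BoundedContinuousFunction.evalCLM ℂ x).comp
      (A.toSubalgebra.toSubmodule.subtypeL)), by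
    constructor
    · intro h
      have h1 := DFunLike.congr_fun h (1 : A)
      exact one_ne_zero (α := ℂ) h1
    · intro f g
      rfl⟩

/-- The boundary (corona): the compactification without the image of `X`. -/
def inducedBoundary {X : Type*} [MetricSpace X] (A : StarSubalgebra ℂ (X →ᵇ ℂ)) :
    Set (InducedCompactification A) :=
  (Set.range (toCompactification A))ᶜ

/-- The sublinear quasi-geodesic compactification. -/
abbrev SublinearQGCompactification {X : Type*} [MetricSpace X] (x₀ : X) : Type _ :=
  InducedCompactification (sublinearAlgebra x₀)

/-- The sublinear quasi-geodesic boundary. -/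
abbrev SublinearQGBoundary {X : Type*} [MetricSpace X] (x₀ : X) : Type _ :=
  inducedBoundary (sublinearAlgebra x₀)

/-- The `κ`-quasi-geodesic compactification. -/
abbrev KappaQGCompactification {X : Type*} [MetricSpace X] (x₀ : X) (κ : ℝ → ℝ) : Type _ :=
  InducedCompactification (kappaAlgebra x₀ κ)

/-- The `κ`-quasi-geodesic boundary. -/
abbrev KappaQGBoundary {X : Type*} [MetricSpace X] (x₀ : X) (κ : ℝ → ℝ) : Type _ :=
  inducedBoundary (kappaAlgebra x₀ κ)

/-- Rays `g` and `h` based at `x₀` `κ`-track each other. -/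
def KappaTrack {X : Type*} [MetricSpace X] (x₀ : X) (κ : ℝ → ℝ) (g h : ℝ → X) : Prop :=
  ∃ C : ℝ, 1 < C ∧ ∀ᶠ t : ℝ in atTop, dist (g t) (h t) ≤ C * κ (dist (g t) x₀)

/-! ### The Gromov product -/

section GromovProduct

variable {X : Type*} [MetricSpace X]

/-! Parts 1 and 2 have one source: every algebra in question consists of the bounded continuous
functions `f` with `f x - f y → 0` as the Gromov product of `x` and `y` tends to infinity
(`IsGromovUniform`), which are those that extend continuously to `X ∪ ∂X`.

Such an `f` is slowly oscillating in every required sense. If `d(x, y) ≤ C κ(‖x‖)` and `‖x‖` is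
large, then `d(x, y) ≤ ‖x‖ / 2`, so the product is at least `‖x‖ / 2`. Two points of an `m`-cone lie
on quasi-geodesics through the common point `g m`, so their product grows linearly in `m`
(`IsDeltaHyperbolic.exists_le_gromovProduct_cone`). Conversely, the cone condition alone forces
uniformity: if it fails along pairs `x n`, `y n` with products tending to infinity, the segments
from `x₀` subconverge to a ray by properness, and by hyperbolicity both points of some pair lie in a
given cone of it (`IsGeometricallySlowlyOscillating.isGromovUniform`).

It remains to identify the characters of this algebra with `X ∪ ∂X`. Limits along representing
sequences define evaluations at boundary points. They separate points, since a metrization of the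
Gromov products supplies enough uniform functions (`GromovClose.exists_separating`), and they
exhaust the characters, since `X ∪ ∂X` is compact (`GromovCompactification.compactSpace`,
`surjective_extendCharacter`). A continuous bijection from a compact space to a Hausdorff one is a
homeomorphism.

Part 3 is the same sublinear estimate: the products of `g t` and `h t` tend to infinity, so the two
rays stay `δ`-close at each fixed time. -/

theorem gromovProduct_comm (a x y : X) : gromovProduct a x y = gromovProduct a y x := by
  simp only [gromovProduct, dist_comm x y]
  ring

theorem gromovProduct_self (a x : X) : gromovProduct a x x = dist x a := by
  simp [gromovProduct]

theorem gromovProduct_le_left (a x y : X) : gromovProduct a x y ≤ dist x a := by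
  have := dist_triangle y x a
  rw [dist_comm y x] at this
  simp only [gromovProduct]
  linarith

theorem gromovProduct_le_right (a x y : X) : gromovProduct a x y ≤ dist y a := by
  rw [gromovProduct_comm]
  exact gromovProduct_le_left a y x

/-- Converts metric closeness into a large product: points far from `a` and relatively close to each
other look alike from `a`. -/
theorem dist_sub_dist_le_gromovProduct (a x y : X) : dist x a - dist x y ≤ gromovProduct a x y := by
  have := dist_triangle x y a
  simp only [gromovProduct]
  linarith

theorem gromovProduct_sub_dist_le (a x y z : X) :
    gromovProduct a x z - dist x y ≤ gromovProduct a y z := by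
  have h1 := dist_triangle x y a
  have h2 := dist_triangle y x z
  rw [dist_comm y x] at h2
  simp only [gromovProduct]
  linarith

theorem gromovProduct_sub_dist_base_le (a b x y : X) :
    gromovProduct a x y - dist a b ≤ gromovProduct b x y := by
  have h1 := dist_triangle x b a
  have h2 := dist_triangle y b a
  rw [dist_comm b a] at h1 h2
  simp only [gromovProduct]
  linarith

theorem dist_eq_sub_gromovProduct (a x y : X) :
    dist x y = dist x a + dist y a - 2 * gromovProduct a x y := by
  simp only [gromovProduct]
  ring

theorem IsDeltaHyperbolic.le_gromovProduct {δ r : ℝ} (hδ : IsDeltaHyperbolic X δ) {a x y z : X}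
    (h1 : r ≤ gromovProduct a x z) (h2 : r ≤ gromovProduct a z y) :
    r - δ / 4 ≤ gromovProduct a x y :=
  (sub_le_sub_right (le_min h1 h2) _).trans (hδ x y z a)

/-- Points at the same distance from the base point on two geodesics with a large Gromov product
of the endpoints are `δ`-close. -/
theorem IsDeltaHyperbolic.dist_le_of_gromovProduct {δ r : ℝ} (hδ : IsDeltaHyperbolic X δ)
    {a x y p q : X} (hp : dist p a = r) (hq : dist q a = r) (hpx : r ≤ gromovProduct a p x)
    (hqy : r ≤ gromovProduct a q y) (hxy : r ≤ gromovProduct a x y) (h0 : 0 ≤ δ) :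
    dist p q ≤ δ := by
  rw [gromovProduct_comm] at hqy
  -- Chaining `p`, `x`, `y`, `q` costs `δ / 4` twice, so the product of `p` and `q` is at least `r -
  -- δ / 2`, and `2 r - 2 (r - δ / 2) = δ`.
  have h1 := hδ.le_gromovProduct hpx hxy
  have h2 := hδ.le_gromovProduct h1 ((by linarith : r - δ / 4 ≤ r).trans hqy)
  rw [dist_eq_sub_gromovProduct a, hp, hq]
  linarith

/-- Along a quasi-geodesic `h`, the Gromov products of `h m` with later points grow linearly
in `m`. -/
theorem IsDeltaHyperbolic.exists_le_gromovProduct_quasiGeodesic {δ k : ℝ}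
    (hδ : IsDeltaHyperbolic X δ) (h0 : 0 ≤ δ) (hk : 1 ≤ k) :
    ∃ C : ℝ, ∀ (N : ℕ∞) (h : ℕ → X), IsIntegralQuasiGeodesic k k N h →
      ∀ m i : ℕ, 1 ≤ m → m ≤ i → (i : ℕ∞) ≤ N →
        (m : ℝ) / k - C ≤ gromovProduct (h 1) (h m) (h i) := by
  have hk0 : 0 < k := by linarith
  -- A jump by `L` indices gains `L / k ≥ δ / 4`, the price of one use of hyperbolicity; the `+ 1`
  -- keeps `L` positive so that the induction descends.
  obtain ⟨L, hL⟩ := exists_nat_ge (k * δ / 4 + 1)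
  have hL1 : 1 ≤ L := by
    have : (1 : ℝ) ≤ L := by nlinarith [mul_nonneg hk0.le h0]
    exact_mod_cast this
  have hLδ : δ / 4 ≤ (L : ℝ) / k := by
    rw [le_div_iff₀ hk0]
    linarith
  refine ⟨1 + k + (k * L + k) / 2 + δ / 4, fun N h hh => ?_⟩
  have near : ∀ m i : ℕ, 1 ≤ m → m ≤ i → (i : ℕ∞) ≤ N → i ≤ m + L →
      (m : ℝ) / k - (1 + k + (k * L + k) / 2) ≤ gromovProduct (h 1) (h m) (h i) := by
    intro m i hm hmi hi hiL
    have hmN : (m : ℕ∞) ≤ N := le_trans (by exact_mod_cast hmi) hi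
    have h1N : ((1 : ℕ) : ℕ∞) ≤ N := le_trans (by exact_mod_cast hm) hmN
    have e1 := (hh m 1 hm hmN le_rfl h1N).1
    have e2 := (hh i 1 (hm.trans hmi) hi le_rfl h1N).1
    have e3 := (hh m i hm hmN (hm.trans hmi) hi).2
    have hm' : (1 : ℝ) ≤ m := by exact_mod_cast hm
    have hmi' : (m : ℝ) ≤ i := by exact_mod_cast hmi
    have hiL' : (i : ℝ) ≤ m + L := by exact_mod_cast hiL
    have e4 : ((m : ℝ) - 1) / k ≤ |(m : ℝ) - (1 : ℕ)| / k := by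
      gcongr
      simpa using le_abs_self ((m : ℝ) - 1)
    have e5 : ((m : ℝ) - 1) / k ≤ |(i : ℝ) - (1 : ℕ)| / k := by
      gcongr
      exact le_trans (by push_cast; linarith) (le_abs_self _)
    have e6 : k * |(m : ℝ) - i| ≤ k * L := by
      gcongr
      rw [abs_le]
      constructor <;> linarith
    have e7 : (1 : ℝ) / k ≤ 1 := by
      rw [div_le_one hk0]
      exact hk
    rw [sub_div] at e4 e5
    simp only [gromovProduct]
    linarith
  intro m i
  induction hn : i - m using Nat.strong_induction_on generalizing m with
  | _ n ih =>
    intro hm hmi hi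
    rcases le_or_gt i (m + L) with hiL | hiL
    · linarith [near m i hm hmi hi hiL]
    -- The bound at `m + L` exceeds the one at `m` by at least `δ / 4`, which absorbs the loss
    -- already contained in it. Hence the losses do not accumulate with the number of jumps.
    · have hmL : ((m + L : ℕ) : ℕ∞) ≤ N := le_trans (by exact_mod_cast hiL.le) hi
      have a1 := near m (m + L) hm (Nat.le_add_right _ _) hmL le_rfl
      have a2 := ih (i - (m + L)) (by omega) (m + L) rfl (by omega) hiL.le hi
      push_cast at a2
      rw [add_div] at a2
      have := hδ.le_gromovProduct a1
        ((by linarith : (m : ℝ) / k - (1 + k + (k * L + k) / 2) ≤ _).trans a2)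
      linarith

/-- Each point of the cone is on a quasi-geodesic through `g m`, hence has a large product with `g
m`; one use of hyperbolicity then compares two such points. -/
theorem IsDeltaHyperbolic.exists_le_gromovProduct_cone {δ k : ℝ}
    (hδ : IsDeltaHyperbolic X δ) (h0 : 0 ≤ δ) (hk : 1 ≤ k) :
    ∃ C : ℝ, ∀ (g : ℕ → X) (m : ℕ), 1 ≤ m → ∀ x ∈ quasiGeodesicCone (g 1) k k g m,
      ∀ y ∈ quasiGeodesicCone (g 1) k k g m, (m : ℝ) / k - C ≤ gromovProduct (g 1) x y := by
  obtain ⟨C, hC⟩ := hδ.exists_le_gromovProduct_quasiGeodesic h0 hk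
  refine ⟨C + δ / 4, fun g m hm => ?_⟩
  have key : ∀ x ∈ quasiGeodesicCone (g 1) k k g m,
      (m : ℝ) / k - C ≤ gromovProduct (g 1) (g m) x := by
    rintro x ⟨N, h, -, hh, h1, hg, i, hmi, hi, rfl⟩
    have := hC N h hh m i hm hmi hi
    rwa [h1, hg m hm le_rfl] at this
  intro x hx y hy
  have h1 := key x hx
  rw [gromovProduct_comm] at h1
  have := hδ.le_gromovProduct h1 (key y hy)
  linarith

end GromovProduct

/-! ### Functions that are uniformly continuous at infinity -/

/-- `f x - f y` tends to zero as the Gromov product of `x` and `y` tends to infinity. -/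
def IsGromovUniform {X : Type*} [MetricSpace X] (x₀ : X) (f : X → ℂ) : Prop :=
  ∀ ε : ℝ, 0 < ε → ∃ R : ℝ, ∀ x y : X, R ≤ gromovProduct x₀ x y → ‖f x - f y‖ ≤ ε

section GromovUniform

variable {X : Type*} [MetricSpace X] {x₀ : X}

theorem IsGromovUniform.isKappaSlowlyOscillating {f : X → ℂ} (hf : IsGromovUniform x₀ f)
    {κ : ℝ → ℝ} (hκ : IsSublinear κ) : IsKappaSlowlyOscillating x₀ κ f := by
  intro C hC ε hε
  obtain ⟨R, hR⟩ := hf ε hε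
  -- Beyond this threshold `C κ(‖x‖) < ‖x‖ / 2`, so the product is at least `‖x‖ / 2 > R`.
  have h1 := hκ.2.eventually (gt_mem_nhds (show (0 : ℝ) < 1 / (2 * C) by positivity))
  obtain ⟨T, hT⟩ := eventually_atTop.1 h1
  refine ⟨Metric.closedBall x₀ (max (max T 1) (2 * R)), Metric.isBounded_closedBall, ?_⟩
  intro x y hx _ hxy
  simp only [Metric.mem_closedBall, not_le, max_lt_iff] at hx
  obtain ⟨⟨hxT, hx1⟩, hxR⟩ := hx
  have h2 := hT _ hxT.le
  rw [div_lt_div_iff₀ (by linarith) (by positivity)] at h2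
  have h3 := dist_sub_dist_le_gromovProduct x₀ x y
  exact hR x y (by nlinarith)

theorem IsGromovUniform.isSublinearlySlowlyOscillating {f : X → ℂ} (hf : IsGromovUniform x₀ f) :
    IsSublinearlySlowlyOscillating x₀ f := by
  intro κ hκ ε hε
  simpa using hf.isKappaSlowlyOscillating hκ 1 one_pos ε hε

theorem IsGromovUniform.isSlowlyOscillating {f : X → ℂ} (hf : IsGromovUniform x₀ f) :
    IsSlowlyOscillating f := by
  rintro x y hx ⟨M, -, hM⟩
  rw [Metric.tendsto_atTop]
  intro ε hε
  obtain ⟨R, hR⟩ := hf (ε / 2) (half_pos hε)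
  have h1 := (Metric.tendsto_dist_right_cobounded_atTop x₀).comp hx
  obtain ⟨n, hn⟩ := eventually_atTop.1 (h1.eventually_ge_atTop (R + M))
  refine ⟨n, fun i hi => ?_⟩
  have h2 := hn i hi
  simp only [Function.comp] at h2
  have h3 := dist_sub_dist_le_gromovProduct x₀ (x i) (y i)
  have := hR (x i) (y i) (by linarith [hM i])
  rw [dist_zero_right]
  linarith

theorem IsGromovUniform.isGeometricallySlowlyOscillating [GromovHyperbolicSpace X] {f : X →ᵇ ℂ}
    (hf : IsGromovUniform x₀ f) : IsGeometricallySlowlyOscillating f := by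
  obtain ⟨δ, h0, hδ⟩ := GromovHyperbolicSpace.exists_delta (X := X)
  refine ⟨hf.isSlowlyOscillating, fun ε hε k hk g _ => ?_⟩
  obtain ⟨C, hC⟩ := hδ.exists_le_gromovProduct_cone h0.le hk
  obtain ⟨R, hR⟩ := hf (ε / 2) (half_pos hε)
  obtain ⟨m, hm⟩ := exists_nat_ge (k * (R + dist (g 1) x₀ + C))
  refine ⟨m + 1, by omega, ?_⟩
  refine lt_of_le_of_lt (Metric.diam_le_of_forall_dist_le (half_pos hε).le ?_) (half_lt_self hε)
  rintro _ ⟨x, hx, rfl⟩ _ ⟨y, hy, rfl⟩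
  rw [dist_eq_norm]
  refine hR x y ?_
  have h1 := hC g (m + 1) (by omega) x hx y hy
  have h2 := gromovProduct_sub_dist_base_le (g 1) x₀ x y
  have h3 : R + dist (g 1) x₀ + C ≤ ((m + 1 : ℕ) : ℝ) / k := by
    rw [le_div_iff₀ (by linarith)]
    push_cast
    linarith
  linarith

/-- A geodesic segment from `x₀` to `x`, sampled at the natural numbers and constant afterwards. -/
theorem IsGeodesicSpace.exists_sampled_segment (hX : IsGeodesicSpace X) (x₀ x : X) :
    ∃ p : ℕ → X, p 0 = x₀ ∧ (∀ i : ℕ, dist x x₀ ≤ i → p i = x) ∧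
      (∀ i : ℕ, (i : ℝ) ≤ dist x x₀ → gromovProduct x₀ (p i) x = i) ∧
      (∀ i : ℕ, dist (p i) x₀ = min (i : ℝ) (dist x x₀)) ∧
      ∀ i j : ℕ, dist (p i) (p j) = |min (i : ℝ) (dist x x₀) - min (j : ℝ) (dist x x₀)| := by
  obtain ⟨γ, h0, h1, h⟩ := hX x₀ x
  rw [dist_comm x₀ x] at h1 h
  have hd : 0 ≤ dist x x₀ := dist_nonneg
  have hm : ∀ i : ℕ, min (i : ℝ) (dist x x₀) ∈ Set.Icc 0 (dist x x₀) :=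
    fun i => ⟨le_min (Nat.cast_nonneg i) hd, min_le_right _ _⟩
  refine ⟨fun i => γ (min (i : ℝ) (dist x x₀)), ?_, ?_, ?_, ?_, fun i j => h _ (hm i) _ (hm j)⟩
  · simp [h0]
  · intro i hi
    simp only [min_eq_right hi, h1]
  · intro i hi
    have e1 : dist (γ i) x₀ = i := by
      rw [← h0, h i ⟨by positivity, hi⟩ 0 ⟨le_rfl, hd⟩]
      simp
    have e2 : dist (γ i) x = dist x x₀ - i := by
      conv_lhs => rw [← h1]
      rw [h i ⟨by positivity, hi⟩ _ ⟨hd, le_rfl⟩, abs_sub_comm, abs_of_nonneg (by linarith)]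
    simp only [min_eq_left hi, gromovProduct, e1, e2]
    ring
  · intro i
    have := h _ (hm i) 0 ⟨le_rfl, hd⟩
    rwa [h0, sub_zero, abs_of_nonneg (hm i).1] at this

/-- If a sampled segment to `x` fellow-travels a ray up to time `m`, then `x` lies in the
`m`-cone of the ray. -/
theorem mem_quasiGeodesicCone_of_fellow_travel {g p : ℕ → X} {x : X} {D k : ℝ} {m : ℕ}
    (hD : 0 ≤ D) (hk : 1 + D ≤ k) (hg0 : g 0 = x₀)
    (hg : ∀ i j : ℕ, dist (g i) (g j) = |(i : ℝ) - j|) (hpx : ∀ i : ℕ, dist x x₀ ≤ i → p i = x)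
    (hp : ∀ i j : ℕ, dist (p i) (p j) = |min (i : ℝ) (dist x x₀) - min (j : ℝ) (dist x x₀)|)
    (hm1 : 1 ≤ m) (hm : (m : ℝ) ≤ dist x x₀) (hgp : ∀ i : ℕ, i < m → dist (g i) (p i) ≤ D) :
    x ∈ quasiGeodesicCone x₀ k k (fun i => g (i - 1)) m := by
  have hk0 : 0 < k := by linarith
  -- The last sampling step may be shorter than one, which costs the additive error 1 in `hp1`.
  set N : ℕ := ⌈dist x x₀⌉₊ with hN
  have hmN : m ≤ N := by
    have := hm.trans (Nat.le_ceil _)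
    exact_mod_cast this
  have hxN : (N : ℝ) < dist x x₀ + 1 := Nat.ceil_lt_add_one dist_nonneg
  have hp1 : ∀ i j : ℕ, i ≤ N → j ≤ N → |dist (p i) (p j) - (|(i : ℝ) - j|)| ≤ 1 := by
    intro i j hi hj
    have hi' : (i : ℝ) ≤ N := by exact_mod_cast hi
    have hj' : (j : ℝ) ≤ N := by exact_mod_cast hj
    rw [hp]
    refine (abs_abs_sub_abs_le_abs_sub _ _).trans ?_
    rw [abs_le]
    constructor <;> rcases min_cases (i : ℝ) (dist x x₀) with h | h <;>
      rcases min_cases (j : ℝ) (dist x x₀) with h' | h' <;> linarith [h.1, h.2, h'.1, h'.2]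
  -- The path follows `g` and then jumps over to `p`; the jump adds at most `D` to the error.
  -- Indices are shifted because quasi-geodesics start at 1.
  set h : ℕ → X := fun i => if i ≤ m then g (i - 1) else p (i - 1) with hh
  have hmix : ∀ i j : ℕ, 1 ≤ i → i ≤ N + 1 → 1 ≤ j → j ≤ N + 1 →
      |dist (h i) (h j) - (|(i : ℝ) - j|)| ≤ 1 + D := by
    intro i j hi hiN hj hjN
    have cast : |((i - 1 : ℕ) : ℝ) - ((j - 1 : ℕ) : ℝ)| = |(i : ℝ) - j| := by
      rw [Nat.cast_sub hi, Nat.cast_sub hj]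
      congr 1
      ring
    have e := hp1 (i - 1) (j - 1) (by omega) (by omega)
    rw [cast, abs_le] at e
    simp only [hh]
    split_ifs with h1 h2 h2
    · rw [hg, cast, sub_self, abs_zero]
      linarith
    · have t1 := dist_triangle (g (i - 1)) (p (i - 1)) (p (j - 1))
      have t2 := dist_triangle_left (p (i - 1)) (p (j - 1)) (g (i - 1))
      have t3 := hgp (i - 1) (by omega)
      rw [abs_le]
      constructor <;> linarith
    · have t1 := dist_triangle_right (p (i - 1)) (g (j - 1)) (p (j - 1))
      have t2 := dist_triangle (p (i - 1)) (g (j - 1)) (p (j - 1))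
      have t3 := hgp (j - 1) (by omega)
      rw [abs_le]
      constructor <;> linarith
    · rw [abs_le]
      constructor <;> linarith
  refine ⟨((N + 1 : ℕ) : ℕ∞), h, by exact_mod_cast hmN.trans (Nat.le_succ _), ?_, ?_, ?_,
    N + 1, hmN.trans (Nat.le_succ _), le_rfl, ?_⟩
  · intro i j hi hiN hj hjN
    have e := abs_le.1 (hmix i j hi (by exact_mod_cast hiN) hj (by exact_mod_cast hjN))
    have a1 : |(i : ℝ) - j| / k ≤ |(i : ℝ) - j| := div_le_self (abs_nonneg _) (by linarith)
    have a2 : |(i : ℝ) - j| ≤ k * |(i : ℝ) - j| :=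
      le_mul_of_one_le_left (abs_nonneg _) (by linarith)
    constructor <;> linarith
  · simp [hh, hm1, hg0]
  · intro i _ him
    simp [hh, him]
  · have : ¬ N + 1 ≤ m := by omega
    simp only [hh, this, if_false, Nat.add_sub_cancel]
    exact hpx N (Nat.le_ceil _)

/-- Argues by contradiction: pairs with products tending to infinity and distant values yield a
limit ray one of whose cones contains both members of a pair, although the image of that cone has
small diameter. -/
theorem IsGeometricallySlowlyOscillating.isGromovUniform [ProperSpace X] [GromovHyperbolicSpace X]
    (hX : IsGeodesicSpace X) (x₀ : X) {f : X →ᵇ ℂ} (hf : IsGeometricallySlowlyOscillating f) :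
    IsGromovUniform x₀ f := by
  obtain ⟨δ, h0, hδ⟩ := GromovHyperbolicSpace.exists_delta (X := X)
  by_contra hcon
  unfold IsGromovUniform at hcon
  push Not at hcon
  obtain ⟨ε, hε, hR⟩ := hcon
  choose x y hxy hfxy using fun n : ℕ => hR n
  choose p hp0 hpx hpg hpd hp using fun n => hX.exists_sampled_segment x₀ (x n)
  choose q hq0 hqy hqg hqd hq using fun n => hX.exists_sampled_segment x₀ (y n)
  -- All sampled segments lie in a product of compact balls, so a subsequence converges pointwise.
  have hball : ∀ n, p n ∈ Set.pi Set.univ fun i : ℕ => Metric.closedBall x₀ (i : ℝ) := by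
    intro n i _
    rw [Metric.mem_closedBall, hpd]
    exact min_le_left _ _
  obtain ⟨g, -, φ, hφ, hlim⟩ :=
    (isCompact_univ_pi fun i : ℕ => isCompact_closedBall x₀ (i : ℝ)).tendsto_subseq hball
  rw [tendsto_pi_nhds] at hlim
  have hxn : ∀ n i : ℕ, i ≤ n → (i : ℝ) ≤ dist (x n) x₀ := fun n i hi =>
    (Nat.cast_le.2 hi).trans ((hxy n).trans (gromovProduct_le_left _ _ _))
  have hyn : ∀ n i : ℕ, i ≤ n → (i : ℝ) ≤ dist (y n) x₀ := fun n i hi =>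
    (Nat.cast_le.2 hi).trans ((hxy n).trans (gromovProduct_le_right _ _ _))
  have hg0 : g 0 = x₀ := by
    refine tendsto_nhds_unique (hlim 0) ?_
    simp only [Function.comp, hp0]
    exact tendsto_const_nhds
  have hg : ∀ i j : ℕ, dist (g i) (g j) = |(i : ℝ) - j| := by
    intro i j
    refine tendsto_nhds_unique ((hlim i).dist (hlim j)) ?_
    refine tendsto_const_nhds.congr' ?_
    filter_upwards [eventually_ge_atTop (max i j)] with n hn
    have hn' : max i j ≤ φ n := hn.trans hφ.le_apply
    simp only [Function.comp]
    rw [hp, min_eq_left (hxn _ _ ((le_max_left _ _).trans hn')),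
      min_eq_left (hxn _ _ ((le_max_right _ _).trans hn'))]
  have hquasi : IsIntegralQuasiGeodesic (2 + δ) (2 + δ) ⊤ (fun i => g (i - 1)) := by
    intro i j hi _ hj _
    have cast : |((i - 1 : ℕ) : ℝ) - ((j - 1 : ℕ) : ℝ)| = |(i : ℝ) - j| := by
      rw [Nat.cast_sub hi, Nat.cast_sub hj]
      congr 1
      ring
    simp only [hg, cast]
    have a1 : |(i : ℝ) - j| / (2 + δ) ≤ |(i : ℝ) - j| := div_le_self (abs_nonneg _) (by linarith)
    have a2 : |(i : ℝ) - j| ≤ (2 + δ) * |(i : ℝ) - j| :=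
      le_mul_of_one_le_left (abs_nonneg _) (by linarith)
    constructor <;> linarith
  -- The segments to `x` follow the limit ray within 1 and those to `y` within `1 + δ`; splicing
  -- adds 1 more, so the constant `2 + δ` serves both.
  obtain ⟨m, hm1, hm⟩ := hf.2 ε hε (2 + δ) (by linarith) _ hquasi
  have hev : ∀ᶠ n in atTop, ∀ i ∈ Finset.range m, dist (g i) (p (φ n) i) < 1 := by
    rw [Filter.eventually_all_finset]
    intro i _
    filter_upwards [(hlim i).eventually (Metric.ball_mem_nhds (g i) one_pos)] with n hn
    rw [dist_comm]
    exact hn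
  obtain ⟨n, hn, hnm⟩ := (hev.and (eventually_ge_atTop m)).exists
  have hmφ : m ≤ φ n := hnm.trans hφ.le_apply
  have hx : x (φ n) ∈ quasiGeodesicCone x₀ (2 + δ) (2 + δ) (fun i => g (i - 1)) m :=
    mem_quasiGeodesicCone_of_fellow_travel zero_le_one (by linarith) hg0 hg (hpx _) (hp _) hm1
      (hxn _ _ hmφ) fun i hi => (hn i (Finset.mem_range.2 hi)).le
  have hy : y (φ n) ∈ quasiGeodesicCone x₀ (2 + δ) (2 + δ) (fun i => g (i - 1)) m := by
    refine mem_quasiGeodesicCone_of_fellow_travel (D := 1 + δ) (by linarith) (by linarith) hg0 hg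
      (hqy _) (hq _) hm1 (hyn _ _ hmφ) fun i hi => ?_
    have hi' := hi.le.trans hmφ
    have hix := hxn _ _ hi'
    have hiy := hyn _ _ hi'
    have d1 : dist (p (φ n) i) x₀ = i := by
      rw [hpd, min_eq_left hix]
    have d2 : dist (q (φ n) i) x₀ = i := by
      rw [hqd, min_eq_left hiy]
    have := hδ.dist_le_of_gromovProduct d1 d2 (hpg _ i hix).ge (hqg _ i hiy).ge
      ((Nat.cast_le.2 hi').trans (hxy _)) h0.le
    have := dist_triangle (g i) (p (φ n) i) (q (φ n) i)
    have := hn i (Finset.mem_range.2 hi)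
    linarith
  have hbd : IsBounded (f '' quasiGeodesicCone x₀ (2 + δ) (2 + δ) (fun i => g (i - 1)) m) :=
    f.isBounded_range.subset (Set.image_subset_range _ _)
  have hle := Metric.dist_le_diam_of_mem hbd (Set.mem_image_of_mem f hx) (Set.mem_image_of_mem f hy)
  simp only [Nat.sub_self, hg0] at hm
  rw [dist_eq_norm] at hle
  linarith [hfxy (φ n)]

theorem mem_sublinearAlgebra_iff [ProperSpace X] [GromovHyperbolicSpace X]
    (hX : IsGeodesicSpace X) (x₀ : X) (f : X →ᵇ ℂ) :
    f ∈ sublinearAlgebra x₀ ↔ IsGromovUniform x₀ f :=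
  ⟨fun hf => hf.1.isGromovUniform hX x₀, fun hf =>
    ⟨hf.isGeometricallySlowlyOscillating, hf.isSublinearlySlowlyOscillating⟩⟩

theorem mem_kappaAlgebra_iff [ProperSpace X] [GromovHyperbolicSpace X]
    (hX : IsGeodesicSpace X) (x₀ : X) {κ : ℝ → ℝ} (hκ : IsSublinear κ) (f : X →ᵇ ℂ) :
    f ∈ kappaAlgebra x₀ κ ↔ IsGromovUniform x₀ f :=
  ⟨fun hf => hf.1.isGromovUniform hX x₀, fun hf =>
    ⟨hf.isGeometricallySlowlyOscillating, hf.isKappaSlowlyOscillating hκ⟩⟩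

end GromovUniform

/-- Sublinearly tracking geodesic rays in a hyperbolic space are at bounded distance. -/
theorem KappaTrack.exists_dist_le {X : Type*} [MetricSpace X] [GromovHyperbolicSpace X] {x₀ : X}
    {κ : ℝ → ℝ} (hκ : IsSublinear κ) {g h : ℝ → X} (hg : IsGeodesicRay x₀ g)
    (hh : IsGeodesicRay x₀ h) (H : KappaTrack x₀ κ g h) :
    ∃ M : ℝ, ∀ t : ℝ, 0 ≤ t → dist (g t) (h t) ≤ M := by
  obtain ⟨δ, h0, hδ⟩ := GromovHyperbolicSpace.exists_delta (X := X)
  obtain ⟨C, hC, hev⟩ := H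
  refine ⟨δ, fun s hs => ?_⟩
  have hnorm : ∀ {g : ℝ → X}, IsGeodesicRay x₀ g → ∀ t, 0 ≤ t → dist (g t) x₀ = t := by
    intro g hg t ht
    rw [← hg.1, hg.2 t 0 ht le_rfl, sub_zero, abs_of_nonneg ht]
  have hprod : ∀ {g : ℝ → X}, IsGeodesicRay x₀ g → ∀ t, s ≤ t →
      s ≤ gromovProduct x₀ (g s) (g t) := by
    intro g hg t ht
    simp only [gromovProduct, hnorm hg s hs, hnorm hg t (hs.trans ht), hg.2 s t hs (hs.trans ht)]
    rw [abs_sub_comm, abs_of_nonneg (by linarith)]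
    linarith
  have h1 := hκ.2.eventually (gt_mem_nhds (show (0 : ℝ) < 1 / (2 * C) by positivity))
  -- At such a `t` the rays are less than `t / 2` apart, so the product of `g t` and `h t` is at
  -- least `t / 2 ≥ s`.
  obtain ⟨t, htκ, htd, hts, ht1⟩ := (h1.and (hev.and ((eventually_ge_atTop (2 * s)).and
    (eventually_ge_atTop 1)))).exists
  rw [div_lt_div_iff₀ (by linarith) (by positivity)] at htκ
  rw [hnorm hg t (by linarith)] at htd
  have h3 := dist_sub_dist_le_gromovProduct x₀ (g t) (h t)
  rw [hnorm hg t (by linarith)] at h3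
  exact hδ.dist_le_of_gromovProduct (hnorm hg s hs) (hnorm hh s hs) (hprod hg t (by linarith))
    (hprod hh t (by linarith)) (by nlinarith) h0.le

/-! ### Extension to the Gromov compactification -/

section Extension

variable {X : Type*} [MetricSpace X] {x₀ : X}

theorem tendsto_swap_atTop_prod {α β : Type*} [Preorder α] [Preorder β] :
    Tendsto (Prod.swap : α × β → β × α) atTop atTop := by
  rw [← prod_atTop_atTop_eq, ← prod_atTop_atTop_eq]
  exact tendsto_snd.prodMk tendsto_fst

theorem tendsto_fst_atTop_prod {α β : Type*} [Preorder α] [Preorder β] :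
    Tendsto (Prod.fst : α × β → α) atTop atTop := by
  rw [← prod_atTop_atTop_eq]
  exact tendsto_fst

theorem tendsto_snd_atTop_prod {α β : Type*} [Preorder α] [Preorder β] :
    Tendsto (Prod.snd : α × β → β) atTop atTop := by
  rw [← prod_atTop_atTop_eq]
  exact tendsto_snd

theorem tendsto_diag_atTop_prod {α : Type*} [Preorder α] :
    Tendsto (fun i : α => (i, i)) atTop atTop := by
  rw [← prod_atTop_atTop_eq]
  exact tendsto_id.prodMk tendsto_id

theorem GromovClose.tendsto_dist {u : ℕ → X} (hu : GromovClose x₀ u u) :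
    Tendsto (fun n => dist (u n) x₀) atTop atTop :=
  (Tendsto.comp hu tendsto_diag_atTop_prod).congr fun n => gromovProduct_self x₀ (u n)

theorem IsGromovUniform.tendsto_sub {f : X → ℂ} (hf : IsGromovUniform x₀ f) {u v : ℕ → X}
    (h : GromovClose x₀ u v) :
    Tendsto (fun p : ℕ × ℕ => f (u p.1) - f (v p.2)) atTop (𝓝 0) := by
  rw [Metric.nhds_basis_closedBall.tendsto_right_iff]
  intro ε hε
  obtain ⟨R, hR⟩ := hf ε hε
  filter_upwards [h.eventually_ge_atTop R] with p hp
  simpa using hR _ _ hp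

theorem IsGromovUniform.exists_tendsto {f : X → ℂ} (hf : IsGromovUniform x₀ f) {u : ℕ → X}
    (hu : GromovClose x₀ u u) : ∃ c, Tendsto (f ∘ u) atTop (𝓝 c) := by
  refine cauchySeq_tendsto_of_complete ?_
  rw [cauchySeq_iff_tendsto, uniformity_eq_comap_nhds_zero ℂ, tendsto_comap_iff]
  exact ((hf.tendsto_sub hu).comp tendsto_swap_atTop_prod).congr fun p => rfl

variable [GromovHyperbolicSpace X]

namespace GromovCompactification

theorem exists_represents (z : GromovCompactification x₀) : ∃ v : ℕ → X, Represents v z := by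
  rcases z with x | ξ
  · exact ⟨fun _ => x, fun _ => rfl⟩
  · obtain ⟨u, rfl⟩ := Quotient.exists_rep ξ
    exact ⟨u.1, u.2, rfl⟩

theorem Represents.gromovClose {ξ : GromovBoundary x₀} {u v : ℕ → X}
    (hu : Represents u (ideal ξ)) (hv : Represents v (ideal ξ)) : GromovClose x₀ u v := by
  obtain ⟨h1, rfl⟩ := hu
  obtain ⟨h2, h⟩ := hv
  exact (Quotient.exact h : GromovClose x₀ v u).symm

theorem Represents.eq_of_gromovClose {ξ η : GromovBoundary x₀} {u v : ℕ → X}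
    (hu : Represents u (ideal ξ)) (hv : Represents v (ideal η)) (h : GromovClose x₀ u v) :
    ξ = η := by
  obtain ⟨h1, rfl⟩ := hu
  obtain ⟨h2, rfl⟩ := hv
  exact Quotient.sound (s := gromovSetoid x₀) h

/-- The extension of `f` to the Gromov compactification by limits along representing sequences. -/
noncomputable def extend (f : X → ℂ) (z : GromovCompactification x₀) : ℂ :=
  limUnder atTop (f ∘ (exists_represents z).choose)

/-- The limit does not depend on the chosen representative, since `f` has vanishing differences
along equivalent sequences. -/
theorem tendsto_extend {f : X → ℂ} (hf : IsGromovUniform x₀ f) {z : GromovCompactification x₀}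
    {v : ℕ → X} (hv : Represents v z) : Tendsto (f ∘ v) atTop (𝓝 (extend f z)) := by
  have hu := (exists_represents z).choose_spec
  unfold extend
  set u := (exists_represents z).choose
  rcases z with x | ξ
  · have h1 : u = v := funext fun j => (hu j).trans (hv j).symm
    have h2 : v = fun _ => x := funext hv
    rw [h1]
    refine tendsto_nhds_limUnder ⟨f x, ?_⟩
    rw [h2]
    exact tendsto_const_nhds
  · have h1 := tendsto_nhds_limUnder (hf.exists_tendsto (hu.gromovClose hu))
    have h2 := (hf.tendsto_sub (hu.gromovClose hv)).comp tendsto_diag_atTop_prod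
    have h3 := h1.sub h2
    rw [sub_zero] at h3
    exact h3.congr fun n => by simp

theorem extend_eq {f : X → ℂ} (hf : IsGromovUniform x₀ f) {z : GromovCompactification x₀}
    {v : ℕ → X} (hv : Represents v z) {c : ℂ} (h : Tendsto (f ∘ v) atTop (𝓝 c)) :
    extend f z = c :=
  tendsto_nhds_unique (tendsto_extend hf hv) h

theorem extend_point {f : X → ℂ} (hf : IsGromovUniform x₀ f) (x : X) :
    extend f (point x : GromovCompactification x₀) = f x :=
  extend_eq hf (z := point x) (v := fun _ => x) (fun _ => rfl) tendsto_const_nhds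

theorem continuous_point : Continuous (point : X → GromovCompactification x₀) :=
  ⟨fun _ hU => hU.1⟩

/-- At a boundary point the uniformity estimate passes to the limit along representing sequences. An
open set only has to contain some `gromovNhd ξ R`, so these sets need not be known to be
neighbourhoods. -/
theorem continuous_extend {f : X → ℂ} (hf : IsGromovUniform x₀ f) (hc : Continuous f) :
    Continuous (extend f : GromovCompactification x₀ → ℂ) := by
  refine ⟨fun V hV => ⟨?_, fun ξ hξ => ?_⟩⟩
  · simp only [Set.mem_preimage, extend_point hf]
    exact hV.preimage hc
  · obtain ⟨ε, hε, hεV⟩ := Metric.isOpen_iff.1 hV _ hξ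
    obtain ⟨R, hR⟩ := hf (ε / 2) (half_pos hε)
    refine ⟨R, ?_⟩
    rintro z ⟨u, v, hu, hv, huv⟩
    refine hεV ?_
    have h1 := (tendsto_extend hf hu).comp (tendsto_fst_atTop_prod (β := ℕ))
    have h2 := (tendsto_extend hf hv).comp (tendsto_snd_atTop_prod (α := ℕ))
    have h3 : ‖extend f (ideal ξ) - extend f z‖ ≤ ε / 2 :=
      le_of_tendsto (h1.sub h2).norm (huv.mono fun p hp => hR _ _ hp)
    rw [mem_ball_iff_norm, norm_sub_rev]
    linarith

/-- A neighbourhood criterion at boundary points. -/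
theorem le_nhds_ideal {F : Filter (GromovCompactification x₀)} {ξ : GromovBoundary x₀}
    (h : ∀ R : ℝ, gromovNhd ξ R ∈ F) : F ≤ 𝓝 (ideal ξ) := by
  rw [le_nhds_iff]
  intro U hξ hU
  obtain ⟨R, hR⟩ := hU.2 ξ hξ
  exact mem_of_superset (h R) hR

/-- A point of the compactification outside of a ball is close to a point of the ball, in terms
of Gromov products. -/
theorem exists_projection (hX : IsGeodesicSpace X) {δ : ℝ} (hδ : IsDeltaHyperbolic X δ)
    (h0 : 0 ≤ δ) (z : GromovCompactification x₀) (n : ℕ)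
    (hz : z ∉ point '' Metric.closedBall x₀ (n : ℝ)) {v : ℕ → X} (hv : Represents v z) :
    ∃ p ∈ Metric.closedBall x₀ (n : ℝ),
      ∀ᶠ i in atTop, (n : ℝ) - δ / 4 ≤ gromovProduct x₀ p (v i) := by
  have hpt : ∀ x : X, (n : ℝ) ≤ dist x x₀ →
      ∃ p ∈ Metric.closedBall x₀ (n : ℝ), (n : ℝ) ≤ gromovProduct x₀ p x := by
    intro x hx
    obtain ⟨p, -, -, h2, h3, -⟩ := hX.exists_sampled_segment x₀ x
    refine ⟨p n, ?_, (h2 n hx).ge⟩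
    rw [Metric.mem_closedBall, h3]
    exact min_le_left _ _
  rcases z with x | ξ
  · have hx : (n : ℝ) ≤ dist x x₀ := by
      by_contra h
      exact hz ⟨x, (not_le.1 h).le, rfl⟩
    obtain ⟨p, hp, hpx⟩ := hpt x hx
    refine ⟨p, hp, Eventually.of_forall fun i => ?_⟩
    rw [hv i]
    linarith
  · have hvv := hv.gromovClose hv
    obtain ⟨⟨a, b⟩, hab⟩ := eventually_atTop.1 (hvv.eventually_ge_atTop (n : ℝ))
    have h1 : (n : ℝ) ≤ dist (v (max a b)) x₀ := by
      have := hab (max a b, max a b) ⟨le_max_left _ _, le_max_right _ _⟩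
      rwa [gromovProduct_self] at this
    obtain ⟨p, hp, hpx⟩ := hpt _ h1
    refine ⟨p, hp, ?_⟩
    filter_upwards [eventually_ge_atTop b] with i hi
    exact hδ.le_gromovProduct hpx (hab (max a b, i) ⟨le_max_left _ _, hi⟩)

/-- The Gromov compactification of a proper geodesic hyperbolic space is compact. -/
theorem compactSpace [ProperSpace X] (hX : IsGeodesicSpace X) (x₀ : X) :
    CompactSpace (GromovCompactification x₀) := by
  obtain ⟨δ, h0, hδ⟩ := GromovHyperbolicSpace.exists_delta (X := X)
  refine ⟨isCompact_iff_ultrafilter_le_nhds.2 fun F _ => ?_⟩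
  by_cases hb : ∃ n : ℕ, point '' Metric.closedBall x₀ (n : ℝ) ∈ F
  · obtain ⟨n, hn⟩ := hb
    obtain ⟨z, -, hz⟩ := isCompact_iff_ultrafilter_le_nhds.1
      ((isCompact_closedBall x₀ (n : ℝ)).image continuous_point) F (le_principal_iff.2 hn)
    exact ⟨z, trivial, hz⟩
  push Not at hb
  have hout : ∀ n : ℕ, ∀ᶠ z in (F : Filter (GromovCompactification x₀)),
      z ∉ point '' Metric.closedBall x₀ (n : ℝ) :=
    fun n => Ultrafilter.compl_mem_iff_notMem.2 (hb n)
  choose v hv using fun z : GromovCompactification x₀ => exists_represents z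
  -- The dummy value `x₀` keeps the projection to the `n`-ball total, so that the image ultrafilter
  -- lives on a compact set. The limits `w n` of these projections will represent the limit of `F`.
  have hproj : ∀ (n : ℕ) (z : GromovCompactification x₀), ∃ p ∈ Metric.closedBall x₀ (n : ℝ),
      z ∉ point '' Metric.closedBall x₀ (n : ℝ) →
        ∀ᶠ i in atTop, (n : ℝ) - δ / 4 ≤ gromovProduct x₀ p (v z i) := by
    intro n z
    by_cases hz : z ∈ point '' Metric.closedBall x₀ (n : ℝ)
    · exact ⟨x₀, by simp, fun h => absurd hz h⟩
    · obtain ⟨p, hp, hpz⟩ := exists_projection hX hδ h0.le z n hz (hv z)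
      exact ⟨p, hp, fun _ => hpz⟩
  choose p hp hpz using hproj
  have hw : ∀ n : ℕ, ∃ w : X, Tendsto (p n) F (𝓝 w) := by
    intro n
    obtain ⟨w, -, hw⟩ := isCompact_iff_ultrafilter_le_nhds.1 (isCompact_closedBall x₀ (n : ℝ))
      (F.map (p n)) (le_principal_iff.2 (Ultrafilter.mem_map.2 (univ_mem' (hp n))))
    exact ⟨w, hw⟩
  choose w hw using hw
  have hnear : ∀ n : ℕ, ∀ᶠ z in (F : Filter (GromovCompactification x₀)),
      ∀ᶠ i in atTop, (n : ℝ) - δ / 4 - 1 ≤ gromovProduct x₀ (w n) (v z i) := by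
    intro n
    filter_upwards [hout n, (hw n).eventually (Metric.ball_mem_nhds _ one_pos)] with z h1 h2
    filter_upwards [hpz n z h1] with i hi
    have h3 := gromovProduct_sub_dist_le x₀ (p n z) (w n) (v z i)
    have h4 : dist (p n z) (w n) < 1 := h2
    linarith
  -- `w n` and `w m` both have large products with the late terms of a sequence representing one
  -- common `z`, provided by the ultrafilter.
  have hww : ∀ n m k : ℕ, k ≤ n → k ≤ m →
      (k : ℝ) - δ / 4 - 1 - δ / 4 ≤ gromovProduct x₀ (w n) (w m) := by
    intro n m k hn hm
    obtain ⟨z, h1, h2⟩ := ((hnear n).and (hnear m)).exists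
    obtain ⟨i, h3, h4⟩ := (h1.and h2).exists
    have hn' : (k : ℝ) ≤ n := by exact_mod_cast hn
    have hm' : (k : ℝ) ≤ m := by exact_mod_cast hm
    rw [gromovProduct_comm] at h4
    exact hδ.le_gromovProduct (by linarith) ((by linarith : _ ≤ (m : ℝ) - δ / 4 - 1).trans h4)
  have hwinf : GromovClose x₀ w w := by
    unfold GromovClose
    rw [tendsto_atTop]
    intro R
    obtain ⟨k, hk⟩ := exists_nat_ge (R + δ / 4 + 1 + δ / 4)
    refine eventually_atTop.2 ⟨(k, k), fun q hq => ?_⟩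
    have := hww q.1 q.2 k hq.1 hq.2
    linarith
  set ξ : GromovBoundary x₀ := Quotient.mk (gromovSetoid x₀) ⟨w, hwinf⟩ with hξ
  refine ⟨ideal ξ, trivial, le_nhds_ideal fun R => ?_⟩
  obtain ⟨k, hk⟩ := exists_nat_ge (R + δ / 4 + 1 + δ / 4 + δ / 4)
  filter_upwards [hnear k] with z hz
  refine ⟨w, v z, ⟨hwinf, rfl⟩, hv z, ?_⟩
  obtain ⟨j, hj⟩ := eventually_atTop.1 hz
  refine eventually_atTop.2 ⟨(k, j), fun q hq => ?_⟩
  have h1 := hww q.1 k k hq.1 le_rfl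
  have h2 := hj q.2 hq.2
  have h3 := hδ.le_gromovProduct h1 ((by linarith : _ ≤ (k : ℝ) - δ / 4 - 1).trans h2)
  linarith

end GromovCompactification

end Extension

/-! ### Separating functions -/

/-- A countable decreasing family of entourages is induced by a pseudometric. -/
theorem exists_pseudometric_of_entourages {Y : Type*} (V : ℕ → Set (Y × Y)) (hanti : Antitone V)
    (hrefl : ∀ n x, (x, x) ∈ V n) (hsymm : ∀ n x y, (x, y) ∈ V n → (y, x) ∈ V n)
    (hcomp : ∀ n, ∃ m, ∀ x y z, (x, y) ∈ V m → (y, z) ∈ V m → (x, z) ∈ V n) :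
    ∃ ρ : Y → Y → ℝ, (∀ x y, 0 ≤ ρ x y) ∧ (∀ x y, ρ x y = ρ y x) ∧
      (∀ x y z, ρ x z ≤ ρ x y + ρ y z) ∧
      (∀ ε > 0, ∃ n, ∀ x y, (x, y) ∈ V n → ρ x y < ε) ∧
      ∀ n, ∃ ε > 0, ∀ x y, ρ x y < ε → (x, y) ∈ V n := by
  have hb : (⨅ n, 𝓟 (V n)).HasBasis (fun _ : ℕ => True) V :=
    hasBasis_iInf_principal (directed_of_isDirected_le (r := (· ≥ ·)) fun m n h => hanti h)
  let U : UniformSpace Y := UniformSpace.ofCore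
    { uniformity := ⨅ n, 𝓟 (V n)
      refl := by
        rw [hb.ge_iff]
        rintro n - ⟨x, y⟩ hxy
        obtain rfl : x = y := by simpa using hxy
        exact hrefl n x
      symm := by
        rw [hb.tendsto_iff hb]
        exact fun n _ => ⟨n, trivial, fun p hp => hsymm n _ _ hp⟩
      comp := by
        rw [hb.ge_iff]
        intro n _
        obtain ⟨m, hm⟩ := hcomp n
        refine (mem_lift'_sets (monotone_id.relComp monotone_id)).2
          ⟨V m, hb.mem_of_mem trivial, ?_⟩
        rintro ⟨x, z⟩ ⟨y, h1, h2⟩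
        exact hm x y z h1 h2 }
  have hU : (uniformity Y).HasBasis (fun _ : ℕ => True) V := hb
  have : (uniformity Y).IsCountablyGenerated := hU.isCountablyGenerated
  -- Metrization of countably generated uniformities; the uniformity of `P` is the given one.
  let P : PseudoMetricSpace Y := UniformSpace.pseudoMetricSpace Y
  refine ⟨P.dist, fun x y => @dist_nonneg Y P x y, P.dist_comm, P.dist_triangle, ?_, ?_⟩
  · intro ε hε
    obtain ⟨n, -, hn⟩ := hU.mem_iff.1
      (@Metric.dist_mem_uniformity Y P ε hε)
    exact ⟨n, fun x y h => hn h⟩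
  · intro n
    obtain ⟨ε, hε, h⟩ := (@Metric.mem_uniformity_dist Y P _).1
      (hU.mem_of_mem (i := n) trivial)
    exact ⟨ε, hε, fun x y hxy => h hxy⟩

section Separation

variable {X : Type*} [MetricSpace X] {x₀ : X}

/-- A pseudometric on a hyperbolic space in which points are close iff they are close for the
metric or have a large Gromov product. -/
theorem exists_visual_pseudometric [GromovHyperbolicSpace X] (x₀ : X) :
    ∃ ρ : X → X → ℝ, (∀ x y, 0 ≤ ρ x y) ∧ (∀ x y, ρ x y = ρ y x) ∧
      (∀ x y z, ρ x z ≤ ρ x y + ρ y z) ∧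
      (∀ ε > 0, ∃ n : ℕ, ∀ x y,
        dist x y ≤ 1 / ((n : ℝ) + 1) ∨ (n : ℝ) ≤ gromovProduct x₀ x y → ρ x y < ε) ∧
      ∀ n : ℕ, ∃ ε > 0, ∀ x y, ρ x y < ε →
        dist x y ≤ 1 / ((n : ℝ) + 1) ∨ (n : ℝ) ≤ gromovProduct x₀ x y := by
  obtain ⟨δ, h0, hδ⟩ := GromovHyperbolicSpace.exists_delta (X := X)
  -- The product of `x` with itself is only `‖x‖`, so the metric alternative is needed for
  -- reflexivity; it also makes functions built from the pseudometric continuous.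
  refine exists_pseudometric_of_entourages
    (fun n : ℕ => {p : X × X | dist p.1 p.2 ≤ 1 / ((n : ℝ) + 1) ∨
      (n : ℝ) ≤ gromovProduct x₀ p.1 p.2}) ?_ ?_ ?_ ?_
  · rintro m n hmn ⟨x, y⟩ (h | h)
    · exact Or.inl (h.trans (Nat.one_div_le_one_div hmn))
    · exact Or.inr ((Nat.cast_le.2 hmn).trans h)
  · intro n x
    left
    rw [dist_self]
    positivity
  · rintro n x y (h | h)
    · exact Or.inl (by rwa [dist_comm])
    · exact Or.inr (by rwa [gromovProduct_comm])
  · intro n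
    obtain ⟨d, hd⟩ := exists_nat_ge (δ / 4)
    have hm : ((2 * n + 1 + d : ℕ) : ℝ) = 2 * n + 1 + d := by push_cast; ring
    have hn : (0 : ℝ) ≤ n := Nat.cast_nonneg n
    have h1 : 1 / (((2 * n + 1 + d : ℕ) : ℝ) + 1) ≤ 1 / (2 * ((n : ℝ) + 1)) := by
      rw [hm]
      gcongr
      linarith
    have h2 : 1 / (2 * ((n : ℝ) + 1)) + 1 / (2 * ((n : ℝ) + 1)) = 1 / ((n : ℝ) + 1) := by
      field_simp
      norm_num
    have h3 : 1 / (((2 * n + 1 + d : ℕ) : ℝ) + 1) ≤ 1 := by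
      rw [div_le_one (by positivity)]
      linarith
    -- The factor 2 halves metric distances, `+ 1` pays for moving an argument of the product by at
    -- most 1, and `d` pays for hyperbolicity.
    refine ⟨2 * n + 1 + d, ?_⟩
    rintro x y z (h | h) (h' | h')
    · left
      have := dist_triangle x y z
      simp only at *
      linarith
    · right
      have := gromovProduct_sub_dist_le x₀ y x z
      rw [dist_comm] at this
      simp only at *
      linarith
    · right
      have := gromovProduct_sub_dist_le x₀ y z x
      rw [gromovProduct_comm x₀ y x, gromovProduct_comm x₀ z x] at this
      simp only at *
      linarith
    · right
      have := hδ.le_gromovProduct h h'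
      simp only at *
      linarith

/-- The candidates are truncated distances to a late term `u N` for a visual pseudometric. If none
separates, `v` ends up as close to `u N` as `u` does, and the triangle inequality makes the products
of `u` and `v` large. -/
theorem GromovClose.exists_separating [GromovHyperbolicSpace X] {u v : ℕ → X}
    (hu : GromovClose x₀ u u) (huv : ¬ GromovClose x₀ u v) :
    ∃ f : X →ᵇ ℂ, IsGromovUniform x₀ f ∧
      ¬ Tendsto (fun n => f (u n) - f (v n)) atTop (𝓝 0) := by
  obtain ⟨ρ, hρ0, hρs, hρt, hρ, hρ'⟩ := exists_visual_pseudometric x₀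
  have hlip : ∀ w x y, |min (ρ x w) 1 - min (ρ y w) 1| ≤ ρ x y := by
    intro w x y
    have h1 := hρt x y w
    have h2 := hρt y x w
    rw [hρs y x] at h2
    have h3 := hρ0 x y
    rw [abs_le]
    constructor <;> rcases min_cases (ρ x w) 1 with h | h <;>
      rcases min_cases (ρ y w) 1 with h' | h' <;> linarith [h.1, h.2, h'.1, h'.2]
  have hnorm : ∀ w x y, ‖((min (ρ x w) 1 : ℝ) : ℂ) - ((min (ρ y w) 1 : ℝ) : ℂ)‖ ≤ ρ x y := by
    intro w x y
    rw [← Complex.ofReal_sub, Complex.norm_real, Real.norm_eq_abs]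
    exact hlip w x y
  have hcont : ∀ w, Continuous fun x => ((min (ρ x w) 1 : ℝ) : ℂ) := by
    intro w
    rw [Metric.continuous_iff]
    intro y ε hε
    obtain ⟨n, hn⟩ := hρ ε hε
    refine ⟨1 / ((n : ℝ) + 1), by positivity, fun x hx => ?_⟩
    rw [dist_eq_norm]
    exact (hnorm w x y).trans_lt (hn x y (Or.inl hx.le))
  let f : X → X →ᵇ ℂ := fun w =>
    BoundedContinuousFunction.ofNormedAddCommGroup (fun x => ((min (ρ x w) 1 : ℝ) : ℂ)) (hcont w) 1
      fun x => by
        rw [Complex.norm_real, Real.norm_of_nonneg (le_min (hρ0 _ _) zero_le_one)]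
        exact min_le_right _ _
  have hf : ∀ w, IsGromovUniform x₀ (f w) := by
    intro w ε hε
    obtain ⟨n, hn⟩ := hρ ε hε
    exact ⟨n, fun x y h => (hnorm w x y).trans (hn x y (Or.inr h)).le⟩
  by_contra hcon
  push Not at hcon
  refine huv ?_
  unfold GromovClose
  rw [tendsto_atTop]
  intro R
  obtain ⟨n, hn⟩ := exists_nat_ge R
  obtain ⟨ε, hε, hεn⟩ := hρ' n
  -- The minimum with 1 keeps the relevant values below the truncation level.
  have hη : 0 < min ε 1 / 4 := by positivity
  obtain ⟨l, hl⟩ := hρ (min ε 1 / 4) hη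
  obtain ⟨⟨a, b⟩, hab⟩ := eventually_atTop.1 (Tendsto.eventually_ge_atTop hu (l : ℝ))
  set N := max a b with hN
  have hu1 : ∀ i, N ≤ i → ρ (u i) (u N) < min ε 1 / 4 := fun i hi =>
    hl _ _ (Or.inr (hab (i, N) ⟨(le_max_left _ _).trans hi, le_max_right _ _⟩))
  have hv1 : ∀ᶠ i in atTop, ρ (v i) (u N) < min ε 1 / 2 := by
    filter_upwards [(hcon _ (hf (u N))).eventually (Metric.ball_mem_nhds 0 hη),
      eventually_ge_atTop N] with i h1 h2
    rw [dist_zero_right] at h1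
    change ‖((min (ρ (u i) (u N)) 1 : ℝ) : ℂ) - ((min (ρ (v i) (u N)) 1 : ℝ) : ℂ)‖ < _ at h1
    rw [← Complex.ofReal_sub, Complex.norm_real, Real.norm_eq_abs, abs_lt] at h1
    have h3 := hu1 i h2
    have h4 := min_le_right ε 1
    have h5 := min_le_left (ρ (u i) (u N)) 1
    rcases min_cases (ρ (v i) (u N)) 1 with h | h <;> linarith [h.1, h.2]
  have hu2 := hu.tendsto_dist.eventually_ge_atTop (R + 1)
  obtain ⟨i₀, hi₀⟩ := eventually_atTop.1 (hu2.and (eventually_ge_atTop N))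
  obtain ⟨j₀, hj₀⟩ := eventually_atTop.1 hv1
  refine eventually_atTop.2 ⟨(i₀, j₀), ?_⟩
  rintro ⟨i, j⟩ ⟨hi, hj⟩
  obtain ⟨h1, h2⟩ := hi₀ i hi
  have h3 := hj₀ j hj
  have h4 := hu1 i h2
  have h5 := hρt (u i) (u N) (v j)
  rw [hρs (u N)] at h5
  have h6 := min_le_left ε 1
  rcases hεn (u i) (v j) (by linarith) with h | h
  -- In the metric alternative the points are within 1, and `‖u i‖ ≥ R + 1` still forces the product
  -- up to `R`.
  · have h7 := dist_sub_dist_le_gromovProduct x₀ (u i) (v j)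
    have h8 : 1 / ((n : ℝ) + 1) ≤ 1 := by
      rw [div_le_one (by positivity)]
      linarith [(Nat.cast_nonneg n : (0 : ℝ) ≤ n)]
    simp only
    linarith
  · exact hn.trans h

/-- A Gromov uniform function that is bounded below has a Gromov uniform inverse. -/
theorem IsGromovUniform.exists_inverse {F : X →ᵇ ℂ} (hF : IsGromovUniform x₀ F) {c : ℝ}
    (hc : 0 < c) (hcF : ∀ x, c ≤ ‖F x‖) :
    ∃ G : X →ᵇ ℂ, IsGromovUniform x₀ G ∧ F * G = 1 := by
  have hne : ∀ x, F x ≠ 0 := fun x => norm_pos_iff.1 (hc.trans_le (hcF x))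
  refine ⟨BoundedContinuousFunction.ofNormedAddCommGroup (fun x => (F x)⁻¹)
    (F.continuous.inv₀ hne) c⁻¹ fun x => ?_, ?_, ?_⟩
  · rw [norm_inv]
    exact inv_anti₀ hc (hcF x)
  · intro ε hε
    obtain ⟨R, hR⟩ := hF (ε * (c * c)) (by positivity)
    refine ⟨R, fun x y h => ?_⟩
    have h1 := hR y x (by rwa [gromovProduct_comm])
    change ‖(F x)⁻¹ - (F y)⁻¹‖ ≤ ε
    rw [inv_sub_inv (hne x) (hne y), norm_div, norm_mul]
    rw [div_le_iff₀ (mul_pos (hc.trans_le (hcF x)) (hc.trans_le (hcF y)))]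
    refine h1.trans ?_
    gcongr
    · exact hcF x
    · exact hcF y
  · ext x
    exact mul_inv_cancel₀ (hne x)

/-- The tent function at a point of `X`. -/
noncomputable def tentFunction (a : X) : X →ᵇ ℂ :=
  BoundedContinuousFunction.ofNormedAddCommGroup (fun x => ((max 0 (1 - dist x a) : ℝ) : ℂ))
    (by fun_prop) 1 (fun x => by
      rw [Complex.norm_real, Real.norm_of_nonneg (le_max_left _ _)]
      exact max_le zero_le_one (sub_le_self _ dist_nonneg))

theorem tentFunction_apply (a x : X) : tentFunction a x = ((max 0 (1 - dist x a) : ℝ) : ℂ) := rfl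

theorem tentFunction_eq_zero (x₀ : X) {a x : X} (h : dist a x₀ + 1 ≤ dist x x₀) :
    tentFunction a x = 0 := by
  have := dist_triangle x a x₀
  rw [tentFunction_apply, max_eq_left (by linarith), Complex.ofReal_zero]

theorem isGromovUniform_tentFunction (x₀ a : X) : IsGromovUniform x₀ (tentFunction a) := by
  intro ε hε
  refine ⟨dist a x₀ + 1, fun x y h => ?_⟩
  rw [tentFunction_eq_zero x₀ (h.trans (gromovProduct_le_left _ _ _)),
    tentFunction_eq_zero x₀ (h.trans (gromovProduct_le_right _ _ _))]
  simpa using hε.le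

namespace GromovCompactification

variable [GromovHyperbolicSpace X]

/-- Distinguishes a point of `X` from every other point at once: the peak is strict, and sequences
representing ideal points leave the support. -/
theorem extend_tentFunction_eq_one_iff (a : X) (z : GromovCompactification x₀) :
    extend (tentFunction a) z = 1 ↔ z = point a := by
  constructor
  · intro h
    rcases z with x | ξ
    · rw [extend_point (isGromovUniform_tentFunction x₀ a), tentFunction_apply] at h
      have h1 : max 0 (1 - dist x a) = 1 := by exact_mod_cast h
      have h2 : dist x a ≤ 0 := by
        rcases max_cases 0 (1 - dist x a) with h' | h' <;> linarith [h'.1, h'.2]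
      rw [dist_le_zero.1 h2]
    · exfalso
      obtain ⟨u, hu⟩ := exists_represents (ideal ξ : GromovCompactification x₀)
      have h0 : extend (tentFunction a) (ideal ξ : GromovCompactification x₀) = 0 := by
        refine extend_eq (isGromovUniform_tentFunction x₀ a) hu ?_
        refine tendsto_const_nhds.congr' ?_
        filter_upwards [(hu.gromovClose hu).tendsto_dist.eventually_ge_atTop (dist a x₀ + 1)]
          with n hn
        exact (tentFunction_eq_zero x₀ hn).symm
      rw [h0] at h
      exact zero_ne_one h
  · rintro rfl
    rw [extend_point (isGromovUniform_tentFunction x₀ a), tentFunction_apply]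
    simp

/-- The extensions of Gromov uniform functions separate the points of the compactification. -/
theorem eq_of_extend_eq {z w : GromovCompactification x₀}
    (h : ∀ f : X →ᵇ ℂ, IsGromovUniform x₀ f → extend f z = extend f w) : z = w := by
  rcases z with x | ξ
  · have := h _ (isGromovUniform_tentFunction x₀ x)
    rw [(extend_tentFunction_eq_one_iff x (point x)).2 rfl, eq_comm,
      extend_tentFunction_eq_one_iff] at this
    exact this.symm
  rcases w with y | η
  · have := h _ (isGromovUniform_tentFunction x₀ y)
    rwa [(extend_tentFunction_eq_one_iff y (point y)).2 rfl,
      extend_tentFunction_eq_one_iff] at this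
  obtain ⟨u, hu⟩ := exists_represents (ideal ξ : GromovCompactification x₀)
  obtain ⟨v, hv⟩ := exists_represents (ideal η : GromovCompactification x₀)
  by_contra hne
  have huv : ¬ GromovClose x₀ u v := fun hc => hne (by rw [hu.eq_of_gromovClose hv hc])
  obtain ⟨f, hf, hlim⟩ := (hu.gromovClose hu).exists_separating huv
  refine hlim ?_
  have := (tendsto_extend hf hu).sub (tendsto_extend hf hv)
  rwa [h f hf, sub_self] at this

end GromovCompactification

end Separation

/-! ### The maximal ideal space -/

section Characters

variable {X : Type*} [MetricSpace X] {x₀ : X} [GromovHyperbolicSpace X]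
  {A : StarSubalgebra ℂ (X →ᵇ ℂ)}

open GromovCompactification

/-- The character of `A` given by evaluating extensions at a point of the Gromov
compactification. -/
noncomputable def extendCharacter (hA : ∀ f ∈ A, IsGromovUniform x₀ f)
    (z : GromovCompactification x₀) : InducedCompactification A :=
  ⟨StrongDual.toWeakDual (LinearMap.mkContinuous
    { toFun := fun f : A => extend f.1 z
      map_add' := fun f g => by
        obtain ⟨v, hv⟩ := exists_represents z
        exact extend_eq (hA _ (f + g).2) hv
          ((tendsto_extend (hA _ f.2) hv).add (tendsto_extend (hA _ g.2) hv))
      map_smul' := fun c f => by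
        obtain ⟨v, hv⟩ := exists_represents z
        exact extend_eq (hA _ (c • f).2) hv
          ((tendsto_extend (hA _ f.2) hv).const_smul c) } 1 fun f => by
        obtain ⟨v, hv⟩ := exists_represents z
        rw [one_mul]
        exact le_of_tendsto (tendsto_extend (hA _ f.2) hv).norm
          (Eventually.of_forall fun n => f.1.norm_coe_le_norm _)), by
    obtain ⟨v, hv⟩ := exists_represents z
    constructor
    · intro h
      have h1 : extend (1 : A).1 z = 0 := DFunLike.congr_fun h (1 : A)
      rw [extend_eq (hA _ (1 : A).2) hv (c := 1) tendsto_const_nhds] at h1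
      exact one_ne_zero h1
    · intro f g
      exact extend_eq (hA _ (f * g).2) hv
        ((tendsto_extend (hA _ f.2) hv).mul (tendsto_extend (hA _ g.2) hv))⟩

theorem extendCharacter_apply (hA : ∀ f ∈ A, IsGromovUniform x₀ f)
    (z : GromovCompactification x₀) (f : A) : extendCharacter hA z f = extend f.1 z := rfl

theorem extendCharacter_point (hA : ∀ f ∈ A, IsGromovUniform x₀ f) (x : X) :
    extendCharacter hA (point x : GromovCompactification x₀) = toCompactification A x := by
  ext f
  exact extend_point (hA _ f.2) x

theorem continuous_extendCharacter (hA : ∀ f ∈ A, IsGromovUniform x₀ f) :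
    Continuous (extendCharacter hA) :=
  Continuous.subtype_mk (WeakDual.continuous_of_continuous_eval fun f =>
    continuous_extend (hA _ f.2) f.1.continuous) _

theorem injective_extendCharacter (hA : ∀ f, f ∈ A ↔ IsGromovUniform x₀ f) :
    Function.Injective (extendCharacter fun f => (hA f).1) := by
  intro z w h
  refine eq_of_extend_eq fun f hf => ?_
  exact DFunLike.congr_fun h (⟨f, (hA f).2 hf⟩ : A)

/-- The Gelfand argument: if a character is no evaluation, compactness gives a finite sum of
elements `star f * f` in its kernel that is positive everywhere, hence invertible in `A`, which is
absurd. -/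
theorem surjective_extendCharacter [CompactSpace (GromovCompactification x₀)]
    (hA : ∀ f, f ∈ A ↔ IsGromovUniform x₀ f) :
    Function.Surjective (extendCharacter fun f => (hA f).1) := by
  intro χ
  by_contra hcon
  push Not at hcon
  have hex : ∀ z : GromovCompactification x₀, ∃ f : A, χ f = 0 ∧ extend f.1 z ≠ 0 := by
    intro z
    by_contra h
    push Not at h
    refine hcon z ?_
    ext f
    -- Subtracting the constant `χ f` puts any `f` into the kernel, so common vanishing at `z` would
    -- make `χ` the evaluation there.
    have h1 : extendCharacter (fun f => (hA f).1) z (f - algebraMap ℂ A (χ f)) = 0 :=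
      h _ (by rw [map_sub, AlgHomClass.commutes]; simp)
    rw [map_sub, AlgHomClass.commutes, sub_eq_zero] at h1
    simpa using h1
  choose f hf0 hfz using hex
  have hcont : ∀ g : A, Continuous (extend g.1 : GromovCompactification x₀ → ℂ) :=
    fun g => continuous_extend ((hA _).1 g.2) g.1.continuous
  obtain ⟨t, ht⟩ := CompactSpace.elim_nhds_subcover
    (fun z => {w : GromovCompactification x₀ | extend (f z).1 w ≠ 0})
    fun z => (isOpen_ne_fun (hcont (f z)) continuous_const).mem_nhds (hfz z)
  set F : A := ∑ z ∈ t, star (f z) * f z with hF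
  have hχF : χ F = 0 := by
    rw [hF, map_sum]
    exact Finset.sum_eq_zero fun z _ => by rw [map_mul, hf0, mul_zero]
  have hFz : ∀ w : GromovCompactification x₀, extend F.1 w =
      ((∑ z ∈ t, ‖extend (f z).1 w‖ ^ 2 : ℝ) : ℂ) := by
    intro w
    change extendCharacter (fun f => (hA f).1) w F = _
    rw [hF, map_sum]
    push_cast
    refine Finset.sum_congr rfl fun z _ => ?_
    obtain ⟨v, hv⟩ := exists_represents w
    rw [map_mul, extendCharacter_apply, extendCharacter_apply,
      extend_eq ((hA _).1 (star (f z)).2) hv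
        (Filter.Tendsto.star (tendsto_extend ((hA _).1 (f z).2) hv))]
    exact Complex.conj_mul' _
  have hpos : ∀ w : GromovCompactification x₀, 0 < ‖extend F.1 w‖ := by
    intro w
    rw [norm_pos_iff, hFz, Complex.ofReal_ne_zero]
    have hw : w ∈ ⋃ z ∈ t, {w : GromovCompactification x₀ | extend (f z).1 w ≠ 0} := by
      rw [ht]
      trivial
    simp only [Set.mem_iUnion, Set.mem_ofPred_eq] at hw
    obtain ⟨z, hz, hzw⟩ := hw
    exact (Finset.sum_pos' (fun _ _ => by positivity) ⟨z, hz, by positivity⟩).ne'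
  -- The minimum over the compactification bounds `F` away from zero on `X`, as inversion within the
  -- uniform functions requires.
  obtain ⟨w, -, hw⟩ := isCompact_univ.exists_isMinOn ⟨point x₀, trivial⟩
    (hcont F).norm.continuousOn
  obtain ⟨G, hG, hFG⟩ := ((hA _).1 F.2).exists_inverse (hpos w) fun x => by
    have := hw (Set.mem_univ (point x))
    simp only [Set.mem_ofPred_eq] at this
    rwa [extend_point ((hA _).1 F.2)] at this
  have h1 : F * (⟨G, (hA G).2 hG⟩ : A) = 1 := Subtype.ext hFG
  have h2 := congrArg χ h1
  rw [map_mul, hχF, zero_mul, map_one] at h2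
  exact zero_ne_one h2

theorem isEmbedding_ideal : IsEmbedding (ideal : GromovBoundary x₀ → GromovCompactification x₀) :=
  ⟨⟨rfl⟩, fun _ _ h => by injection h⟩

/-- An algebra consisting of the bounded continuous Gromov uniform functions induces the Gromov
compactification. -/
theorem exists_homeomorph_gromovCompactification [ProperSpace X] (hX : IsGeodesicSpace X)
    (hA : ∀ f, f ∈ A ↔ IsGromovUniform x₀ f) :
    ∃ (Φ : InducedCompactification A ≃ₜ GromovCompactification x₀)
      (φ : inducedBoundary A ≃ₜ GromovBoundary x₀),
      (∀ x : X, Φ (toCompactification A x) = point x) ∧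
      ∀ p : inducedBoundary A, Φ p.1 = ideal (φ p) := by
  have := compactSpace hX x₀
  let e := Equiv.ofBijective _ ⟨injective_extendCharacter hA, surjective_extendCharacter hA⟩
  have he : Continuous e := continuous_extendCharacter fun f => (hA f).1
  -- Only the character space has to be Hausdorff here; for `X ∪ ∂X` this property then follows.
  let Φ : InducedCompactification A ≃ₜ GromovCompactification x₀ :=
    (he.homeoOfEquivCompactToT2).symm
  have hpt : ∀ x : X, Φ (toCompactification A x) = point x := by
    intro x
    rw [← extendCharacter_point (x₀ := x₀) (fun f => (hA f).1) x]
    exact e.symm_apply_apply _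
  have hset : inducedBoundary A = Φ ⁻¹' Set.range ideal := by
    ext p
    simp only [inducedBoundary, Set.mem_compl_iff, Set.mem_range, Set.mem_preimage]
    constructor
    · intro h
      rcases hp : Φ p with x | ξ
      · exact absurd ⟨x, Φ.injective ((hpt x).trans hp.symm)⟩ h
      · exact ⟨ξ, rfl⟩
    · rintro ⟨ξ, hξ⟩ ⟨x, rfl⟩
      rw [hpt] at hξ
      injection hξ
  let ψ : inducedBoundary A ≃ₜ Set.range (ideal : GromovBoundary x₀ → GromovCompactification x₀) :=
    Φ.sets hset
  refine ⟨Φ, ψ.trans isEmbedding_ideal.toHomeomorph.symm, hpt, fun p => ?_⟩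
  have := isEmbedding_ideal.toHomeomorph.apply_symm_apply (ψ p)
  exact (congrArg Subtype.val this).symm

end Characters

theorem proposition6p8 {X : Type*} [MetricSpace X] [ProperSpace X] [GromovHyperbolicSpace X]
    (hX : IsGeodesicSpace X) (x₀ : X) :
    (∃ (Φ : SublinearQGCompactification x₀ ≃ₜ GromovCompactification x₀)
        (φ : SublinearQGBoundary x₀ ≃ₜ GromovBoundary x₀),
      (∀ x : X, Φ (toCompactification (sublinearAlgebra x₀) x) =
        GromovCompactification.point x) ∧
      ∀ p : SublinearQGBoundary x₀, Φ p.1 = GromovCompactification.ideal (φ p)) ∧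
    (∀ κ : ℝ → ℝ, IsSublinear κ →
      ∃ (Φ : KappaQGCompactification x₀ κ ≃ₜ GromovCompactification x₀)
        (φ : KappaQGBoundary x₀ κ ≃ₜ GromovBoundary x₀),
      (∀ x : X, Φ (toCompactification (kappaAlgebra x₀ κ) x) =
        GromovCompactification.point x) ∧
      ∀ p : KappaQGBoundary x₀ κ, Φ p.1 = GromovCompactification.ideal (φ p)) ∧
    (∀ κ : ℝ → ℝ, IsSublinear κ → ∀ g h : ℝ → X, IsGeodesicRay x₀ g → IsGeodesicRay x₀ h →
      KappaTrack x₀ κ g h → ∃ M : ℝ, ∀ t : ℝ, 0 ≤ t → dist (g t) (h t) ≤ M) := by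
  exact ⟨exists_homeomorph_gromovCompactification hX (mem_sublinearAlgebra_iff hX x₀),
    fun κ hκ => exists_homeomorph_gromovCompactification hX (mem_kappaAlgebra_iff hX x₀ hκ),
    fun κ hκ g h hg hh H => H.exists_dist_le hκ hg hh⟩
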